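/- Let $n\ge 0$ and let $\mathcal F^2(\mathbb C^n)$ be the Fock space of all holomorphic functions $f:\mathbb C^n\to\mathbb C$ with $$\|f\|^2=\frac1{(2\pi)^n}\int_{\mathbb C^n}|f(z)|^2e^{-|z|^2/2}\,dv(z)<\infty,$$ where $|z|$ is the Euclidean norm and $dv$ is Lebesgue measure on $\mathbb C^n$. Let $\varphi:\mathbb C^n\to\mathbb C^n$ be holomorphic, and suppose that the composition operator $C_\varphi f=f\circ\varphi$ is a bounded linear operator from $\mathcal F^2(\mathbb C^n)$ to itself. Then there are a matrix $A\in\mathbb C^{n\times n}$ and a vector $B\in\mathbb C^n$ such that $\varphi(z)=Az+B$ for all $z\in\mathbb C^n$, and the spectrum of $C_\varphi$ on $\mathcal F^2(\mathbb C^n)$ is $$\sigma(C_\varphi)=\overline{\{\lambda_1^{\alpha_1}\cdots\lambda_n^{\alpha_n}:\ (\alpha_1,\ldots,\alpha_n)\in\mathbb N^n\}},$$ where $\lambda_1,\ldots,\lambda_n$ are the eigenvalues of $A$, repeated according to algebraic multiplicity, $0\in\mathbb N$, and $0^0=1$. -/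

import Mathlib

open MeasureTheory Polynomial
open scoped ENNReal

noncomputable section

/-- Complex Euclidean space of dimension `n`, with `|z|² = ∑ |z_j|²`. -/
abbrev CSpace (n : ℕ) : Type := EuclideanSpace ℂ (Fin n)

/-- The Gaussian measure `(2π)^{-n} exp(-|z|²/2) dv(z)`, where `dv` is Lebesgue volume. -/
def fockMeasure (n : ℕ) : Measure (CSpace n) :=
  volume.withDensity fun z => ENNReal.ofReal (((2 * Real.pi) ^ n)⁻¹ * Real.exp (-(‖z‖ ^ 2 / 2)))

/-- The holomorphic functions on `ℂⁿ` that are square integrable for the Gaussian measure. -/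
def fockSubmodule (n : ℕ) : Submodule ℂ (CSpace n → ℂ) where
  carrier := {f | Differentiable ℂ f ∧ MemLp f 2 (fockMeasure n)}
  add_mem' := fun hf hg => ⟨hf.1.add hg.1, hf.2.add hg.2⟩
  zero_mem' := ⟨differentiable_const 0, MemLp.zero⟩
  smul_mem' := fun c _ hf => ⟨hf.1.const_smul c, hf.2.const_smul c⟩

/-- The Fock space `F²(ℂⁿ)`; its elements are genuine functions. -/
def Fock (n : ℕ) : Type := fockSubmodule n

namespace Fock

variable {n : ℕ}

instance : AddCommGroup (Fock n) := inferInstanceAs (AddCommGroup (fockSubmodule n))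

instance : Module ℂ (Fock n) := inferInstanceAs (Module ℂ (fockSubmodule n))

instance : FunLike (Fock n) (CSpace n) ℂ where
  coe f := (show fockSubmodule n from f).1
  coe_injective _ _ h := Subtype.ext h

/-- A function of `fockSubmodule n` as an element of the Fock space. -/
def mk (f : CSpace n → ℂ) (hf : f ∈ fockSubmodule n) : Fock n :=
  (show fockSubmodule n from ⟨f, hf⟩)

theorem mk_apply (f : CSpace n → ℂ) (hf : f ∈ fockSubmodule n) (z : CSpace n) :
    mk f hf z = f z := rfl

theorem mem (f : Fock n) : (f : CSpace n → ℂ) ∈ fockSubmodule n :=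
  (show fockSubmodule n from f).2

theorem differentiable (f : Fock n) : Differentiable ℂ f := f.mem.1

theorem memLp (f : Fock n) : MemLp f 2 (fockMeasure n) := f.mem.2

theorem volume_absolutelyContinuous : (volume : Measure (CSpace n)) ≪ fockMeasure n := by
  refine withDensity_absolutelyContinuous' ?_ ?_
  · fun_prop
  · refine Filter.Eventually.of_forall fun z => ?_
    rw [Ne, ENNReal.ofReal_eq_zero, not_le]
    positivity

/-- The class of a function of the Fock space in `L²` of the Gaussian measure. -/
def toL2 (n : ℕ) : Fock n →ₗ[ℂ] Lp ℂ 2 (fockMeasure n) where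
  toFun f := f.memLp.toLp f
  map_add' f g := MemLp.toLp_add f.memLp g.memLp
  map_smul' c f := MemLp.toLp_const_smul c f.memLp

theorem toL2_injective : Function.Injective (toL2 n) := by
  intro f g h
  have h1 : (f : CSpace n → ℂ) =ᵐ[fockMeasure n] g := (MemLp.toLp_eq_toLp_iff f.memLp g.memLp).1 h
  have h2 : (f : CSpace n → ℂ) =ᵐ[volume] g := volume_absolutelyContinuous.ae_le h1
  exact DFunLike.coe_injective
    ((f.differentiable.continuous.ae_eq_iff_eq volume g.differentiable.continuous).1 h2)

/-- The norm is the `L²` norm; see `Fock.norm_sq_eq`. -/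
instance : NormedAddCommGroup (Fock n) :=
  NormedAddCommGroup.induced (Fock n) (Lp ℂ 2 (fockMeasure n)) (toL2 n) toL2_injective

theorem norm_eq (f : Fock n) : ‖f‖ = ‖toL2 n f‖ := rfl

/-- The inner product is that of `L²`, conjugate linear in the first variable as in Mathlib. -/
instance : InnerProductSpace ℂ (Fock n) where
  norm_smul_le c f := by
    rw [norm_eq, norm_eq, map_smul]
    exact norm_smul_le c _
  inner f g := inner ℂ (toL2 n f) (toL2 n g)
  norm_sq_eq_re_inner f := norm_sq_eq_re_inner (𝕜 := ℂ) (toL2 n f)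
  conj_inner_symm f g := inner_conj_symm (toL2 n f) (toL2 n g)
  add_left f g h := by rw [map_add, inner_add_left]
  smul_left f g c := by rw [map_smul, inner_smul_left]

theorem norm_sq_eq (f : Fock n) : ‖f‖ ^ 2 = ∫ z, ‖f z‖ ^ 2 ∂(fockMeasure n) := by
  have h : ((‖toL2 n f‖ ^ 2 : ℝ) : ℂ) = ∫ z, ((‖f z‖ ^ 2 : ℝ) : ℂ) ∂(fockMeasure n) := by
    have h0 := inner_self_eq_norm_sq_to_K (𝕜 := ℂ) (toL2 n f)
    rw [L2.inner_def] at h0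
    push_cast
    refine h0.symm.trans (integral_congr_ae ?_)
    filter_upwards [f.memLp.coeFn_toLp] with z hz
    have hz' : (toL2 n f : CSpace n → ℂ) z = f z := hz
    rw [hz', inner_self_eq_norm_sq_to_K]
    rfl
  rw [norm_eq]
  exact Complex.ofReal_injective (h.trans integral_complex_ofReal)

end Fock

/-- `C_φ` is a bounded operator on `F²(ℂⁿ)`: the function `f ∘ φ` belongs to `F²(ℂⁿ)` for every
`f` in `F²(ℂⁿ)`, with a norm bounded by a constant times that of `f`. -/
def BoundedComposition {n : ℕ} (φ : CSpace n → CSpace n) : Prop :=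
  ∃ h : ∀ f : Fock n, (fun z => f (φ z)) ∈ fockSubmodule n,
    ∃ c : ℝ, ∀ f : Fock n, ‖Fock.mk (fun z => f (φ z)) (h f)‖ ≤ c * ‖f‖

/-- The composition operator `C_φ f = f ∘ φ` on `F²(ℂⁿ)`. -/
def compositionOperator {n : ℕ} (φ : CSpace n → CSpace n) (hφ : BoundedComposition φ) :
    Fock n →L[ℂ] Fock n :=
  LinearMap.mkContinuousOfExistsBound
    { toFun := fun f => Fock.mk (fun z => f (φ z)) (hφ.1 f)
      map_add' := fun _ _ => rfl
      map_smul' := fun _ _ => rfl }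
    hφ.2

theorem compositionOperator_apply {n : ℕ} (φ : CSpace n → CSpace n) (hφ : BoundedComposition φ)
    (f : Fock n) (z : CSpace n) : compositionOperator φ hφ f z = f (φ z) := rfl

end

/-! Testing `C_φ` on normalised reproducing kernels gives `‖φ w‖² ≤ ‖w‖² + c`. By Liouville's
theorem `φ z = A z + B`; growth along rays makes `A` a contraction, and the term linear in `t` of
the estimate at `t • x` makes `B` orthogonal to every eigenvector `x` of `A` with unimodular
eigenvalue. Such eigenvectors span the range of an orthogonal projection `U` commuting with `A`; `A`
is isometric there, while its powers tend to `0` on the range of `V = 1 - U`. Hence `φ` has a fixed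
point `p` in the range of `V`. Let `D` be the multiplicative monoid generated by the eigenvalues of
`A`; the claim is that the spectrum is `closure D`.

Products of eigenfunctionals of `A`, evaluated at `z - p`, are eigenfunctions in the Fock space with
eigenvalues exhausting `D`. As the spectrum is closed, it contains `closure D`
(`mem_spectrum_compositionOperator`).

Conversely, factor `C_φ = R S` with commuting `R` and `S`: `R` is composition with the unitary map
`W` that is `A` on the range of `U` and the identity on the range of `V`, and `S` moves only the
`V`-part. The spectrum of `R` lies in `closure D`: it lies on the circle, and a subgroup of the
circle is dense or finite, so only torsion relations matter, and a relation `l ^ N = 1` for all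
unimodular eigenvalues gives `R ^ N = 1`. Now let `μ ≠ 0` lie outside `closure D`, and expand
functions in homogeneous components along the range of `V` around `p`. On the component of degree
`j`, `S` is annihilated by a polynomial whose roots `a` are products of `j` eigenvalues of `A * V`;
each `a R - μ` is invertible because `closure D` is a monoid, and this inverts `R S - μ` on the
component (`exists_relative_inverse`). On the remainder after sufficiently many components a fixed
power of `R S` has small norm, so a Neumann series applies (`exists_relative_inverse_of_pow`). The
finitely many partial inverses add up to an inverse. If `0` is outside `closure D`, every eigenvalue
is unimodular, `V = 0`, and `C_φ = R` is invertible.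

The norm estimates rest on `exists_norm_le_of_circle_average`: averaging over a circle of injective
affine maps replaces a change of variables when `A` is singular. -/

/-! ### Holomorphic functions of several variables -/

section SeveralVariables

variable {E : Type*} [NormedAddCommGroup E] [NormedSpace ℂ E]

theorem hasDerivAt_comp_line {f : E → ℂ} (hf : Differentiable ℂ f) (z w : E) (t : ℂ) :
    HasDerivAt (fun t : ℂ => f (z + t • w)) (fderiv ℂ f (z + t • w) w) t := by
  have h1 : HasDerivAt (fun t : ℂ => z + t • w) w t := by
    simpa using ((hasDerivAt_id t).smul_const w).const_add z
  exact (hf (z + t • w)).hasFDerivAt.comp_hasDerivAt t h1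

theorem differentiable_comp_line {f : E → ℂ} (hf : Differentiable ℂ f) (z w : E) :
    Differentiable ℂ (fun t : ℂ => f (z + t • w)) :=
  fun t => (hasDerivAt_comp_line hf z w t).differentiableAt

theorem norm_fderiv_le_of_forall_mem_closedBall {f : E → ℂ} (hf : Differentiable ℂ f) {z : E}
    {c : ℝ} (hc : ∀ y ∈ Metric.closedBall z 1, ‖f y‖ ≤ c) : ‖fderiv ℂ f z‖ ≤ c := by
  have hc0 : 0 ≤ c := (norm_nonneg _).trans (hc z (by simp))
  refine ContinuousLinearMap.opNorm_le_bound _ hc0 fun w => ?_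
  rcases eq_or_ne w 0 with rfl | hw
  · simp
  have hw' : 0 < ‖w‖ := norm_pos_iff.2 hw
  have h := Complex.norm_deriv_le_of_forall_mem_sphere_norm_le (c := 0) (R := ‖w‖⁻¹) (C := c)
    (f := fun t : ℂ => f (z + t • w)) (by positivity)
    (differentiable_comp_line hf z w).diffContOnCl ?_
  · rw [(hasDerivAt_comp_line hf z w 0).deriv] at h
    simpa [div_eq_mul_inv] using h
  · intro t ht
    refine hc _ ?_
    have : ‖t‖ = ‖w‖⁻¹ := by simpa using ht
    simp [norm_smul, this, hw'.ne']

/-- Weierstrass' theorem: Cauchy's estimate on unit balls turns uniform convergence of the functions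
into uniform convergence of their derivatives. -/
theorem differentiable_of_tendstoUniformlyOn_closedBall {F : ℕ → E → ℂ} {g : E → ℂ}
    (hF : ∀ k, Differentiable ℂ (F k))
    (hg : ∀ r : ℝ, TendstoUniformlyOn F g Filter.atTop (Metric.closedBall 0 r)) :
    Differentiable ℂ g := by
  intro z
  set s := Metric.ball z 1
  have hcauchy : UniformCauchySeqOn (fun k => fderiv ℂ (F k)) Filter.atTop s := by
    rw [Metric.uniformCauchySeqOn_iff]
    intro ε hε
    obtain ⟨N, hN⟩ := Metric.uniformCauchySeqOn_iff.1 (hg (‖z‖ + 2)).uniformCauchySeqOn (ε / 2)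
      (half_pos hε)
    refine ⟨N, fun k hk l hl y hy => ?_⟩
    rw [dist_eq_norm]
    have h1 : fderiv ℂ (F k) y - fderiv ℂ (F l) y = fderiv ℂ (fun x => F k x - F l x) y :=
      (fderiv_fun_sub (hF k y) (hF l y)).symm
    rw [h1]
    refine lt_of_le_of_lt (norm_fderiv_le_of_forall_mem_closedBall (c := ε / 2)
      ((hF k).sub (hF l)) fun x hx => ?_) (half_lt_self hε)
    have hx' : x ∈ Metric.closedBall (0 : E) (‖z‖ + 2) := by
      rw [mem_closedBall_zero_iff]
      have h2 : dist x z ≤ dist x y + dist y z := dist_triangle _ _ _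
      have h3 : dist x y ≤ 1 := hx
      have h4 : dist y z < 1 := hy
      have h5 : ‖x‖ ≤ ‖z‖ + dist x z := by
        rw [dist_eq_norm]
        calc ‖x‖ = ‖z + (x - z)‖ := by congr 1; abel
          _ ≤ _ := norm_add_le _ _
      linarith
    have := hN k hk l hl x hx'
    rw [dist_eq_norm] at this
    exact this.le
  have hlim : ∀ y ∈ s, ∃ L, Filter.Tendsto (fun k => fderiv ℂ (F k) y) Filter.atTop (nhds L) :=
    fun y hy => cauchySeq_tendsto_of_complete (hcauchy.cauchySeq hy)
  classical
  set g' : E → E →L[ℂ] ℂ := fun y => if hy : y ∈ s then (hlim y hy).choose else 0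
  have hg' : ∀ y ∈ s, Filter.Tendsto (fun k => fderiv ℂ (F k) y) Filter.atTop (nhds (g' y)) := by
    intro y hy
    simp only [g', dif_pos hy]
    exact (hlim y hy).choose_spec
  have hz : z ∈ s := Metric.mem_ball_self one_pos
  exact (hasFDerivAt_of_tendstoUniformlyOn Metric.isOpen_ball
    (hcauchy.tendstoUniformlyOn_of_tendsto hg') (fun k y _ => (hF k y).hasFDerivAt)
    (fun y _ => (hg ‖y‖).tendsto_at (by simp)) hz).differentiableAt

/-- The maximum principle bounds the difference quotient by `2 * c` on the unit disc, and the
Schwarz lemma applied to it gives the linear rate. The constant depends on `c` only, so the rate is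
uniform over families of slices. -/
theorem norm_dslope_sub_le {h : ℂ → ℂ} (hh : Differentiable ℂ h) {c : ℝ}
    (hc : ∀ t ∈ Metric.closedBall (0 : ℂ) 1, ‖h t‖ ≤ c) {t : ℂ} (ht : ‖t‖ < 1) :
    ‖dslope h 0 t - deriv h 0‖ ≤ (4 * c + 1) * ‖t‖ := by
  have hd : Differentiable ℂ (dslope h 0) := by
    have := (Complex.differentiableOn_dslope (s := Set.univ) (c := (0 : ℂ)) (f := h)
      Filter.univ_mem).2 hh.differentiableOn
    exact differentiableOn_univ.1 this
  have hb : ∀ x ∈ Metric.closedBall (0 : ℂ) 1, ‖dslope h 0 x‖ ≤ 2 * c := by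
    intro x hx
    refine Complex.norm_le_of_forall_mem_frontier_norm_le (U := Metric.ball (0 : ℂ) 1)
      Metric.isBounded_ball hd.diffContOnCl ?_ (by rwa [closure_ball _ one_ne_zero])
    intro y hy
    rw [frontier_ball _ one_ne_zero, mem_sphere_zero_iff_norm] at hy
    have hy0 : y ≠ 0 := by
      rintro rfl
      simp at hy
    rw [dslope_of_ne _ hy0, slope_def_field, norm_div, sub_zero, hy, div_one]
    have h1 := hc y (by simp [hy])
    have h2 := hc 0 (by simp)
    linarith [norm_sub_le (h y) (h 0)]
  have h0 := hb 0 (by simp)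
  have := Complex.dist_le_div_mul_dist_of_mapsTo_ball (f := dslope h 0) (c := 0) (z := t)
    (R₁ := 1) (R₂ := 4 * c + 1) hd.differentiableOn ?_ (by simpa using ht)
  · simpa [dist_eq_norm, dslope_same] using this
  · intro x hx
    have h1 := hb x (Metric.ball_subset_closedBall hx)
    rw [Metric.mem_closedBall, dist_eq_norm]
    linarith [norm_sub_le (dslope h 0 x) (dslope h 0 0)]

variable [FiniteDimensional ℂ E]

/-- A directional derivative is a locally uniform limit of difference quotients, here with steps `1
/ (k + 2)`, which are nonzero and less than `1`. Iterating this gives smoothness. -/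
theorem differentiable_fderiv_apply {f : E → ℂ} (hf : Differentiable ℂ f) (w : E) :
    Differentiable ℂ (fun z => fderiv ℂ f z w) := by
  have : ProperSpace E := FiniteDimensional.proper ℂ E
  set u : ℕ → ℂ := fun k => ((k : ℂ) + 2)⁻¹ with hu
  have hu_norm : ∀ k, ‖u k‖ = ((k : ℝ) + 2)⁻¹ := by
    intro k
    rw [hu]
    simp only [norm_inv]
    congr 1
    rw [show (k : ℂ) + 2 = ((k + 2 : ℝ) : ℂ) by push_cast; ring, Complex.norm_real,
      Real.norm_of_nonneg (by positivity)]
  have hu0 : ∀ k, u k ≠ 0 := fun k => norm_pos_iff.1 (by rw [hu_norm]; positivity)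
  have hu1 : ∀ k, ‖u k‖ < 1 := by
    intro k
    rw [hu_norm]
    exact inv_lt_one_of_one_lt₀ (by linarith [Nat.cast_nonneg (α := ℝ) k])
  have hut : Filter.Tendsto (fun k => ‖u k‖) Filter.atTop (nhds 0) := by
    simp_rw [hu_norm]
    exact tendsto_inv_atTop_zero.comp
      (Filter.tendsto_atTop_add_const_right _ _ tendsto_natCast_atTop_atTop)
  refine differentiable_of_tendstoUniformlyOn_closedBall
    (F := fun k z => (u k)⁻¹ * (f (z + u k • w) - f z)) (fun k => ?_) (fun r => ?_)
  · exact ((hf.comp (differentiable_id.add_const _)).sub hf).const_mul _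
  obtain ⟨c, hc⟩ := (isCompact_closedBall (0 : E) (r + ‖w‖)).exists_bound_of_continuousOn
    hf.continuous.continuousOn
  have hkey : ∀ k, ∀ z ∈ Metric.closedBall (0 : E) r,
      dist (fderiv ℂ f z w) ((u k)⁻¹ * (f (z + u k • w) - f z)) ≤ (4 * c + 1) * ‖u k‖ := by
    intro k z hz
    have h := norm_dslope_sub_le (differentiable_comp_line hf z w) (c := c) ?_ (hu1 k)
    · rw [(hasDerivAt_comp_line hf z w 0).deriv, dslope_of_ne _ (hu0 k), slope_def_field] at h
      rw [dist_comm, dist_eq_norm]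
      simpa [div_eq_inv_mul] using h
    · intro t ht
      refine hc _ ?_
      rw [mem_closedBall_zero_iff] at *
      calc ‖z + t • w‖ ≤ ‖z‖ + ‖t‖ * ‖w‖ := (norm_add_le _ _).trans (by rw [norm_smul])
        _ ≤ r + ‖w‖ := add_le_add hz (mul_le_of_le_one_left (norm_nonneg _) ht)
  rw [Metric.tendstoUniformlyOn_iff]
  intro ε hε
  have ht : Filter.Tendsto (fun k => (4 * c + 1) * ‖u k‖) Filter.atTop (nhds 0) := by
    simpa using hut.const_mul (4 * c + 1)
  filter_upwards [ht.eventually_lt_const hε] with k hk z hz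
  exact (hkey k z hz).trans_lt hk

theorem contDiff_nat_of_differentiable {f : E → ℂ} (hf : Differentiable ℂ f) (m : ℕ) :
    ContDiff ℂ m f := by
  induction m generalizing f with
  | zero => exact contDiff_zero.2 hf.continuous
  | succ m ih =>
    rw [show ((m + 1 : ℕ) : WithTop ℕ∞) = (m : WithTop ℕ∞) + 1 by push_cast; rfl,
      contDiff_succ_iff_fderiv_apply]
    exact ⟨hf, by simp, fun y => ih (differentiable_fderiv_apply hf y)⟩

theorem iteratedDeriv_comp_line {f : E → ℂ} (hf : Differentiable ℂ f) (x v : E) (j : ℕ) :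
    iteratedDeriv j (fun t : ℂ => f (x + t • v)) 0 = iteratedFDeriv ℂ j f x fun _ => v := by
  set L : ℂ →L[ℂ] E := ContinuousLinearMap.toSpanSingleton ℂ v
  have h1 : ContDiff ℂ j (fun y => f (x + y)) :=
    (contDiff_nat_of_differentiable hf j).comp (contDiff_const.add contDiff_id)
  have h2 := L.iteratedFDeriv_comp_right h1 0 (i := j) le_rfl
  have h3 : (fun t : ℂ => f (x + t • v)) = (fun y => f (x + y)) ∘ L := by
    ext t
    simp [L]
  rw [iteratedDeriv_eq_iteratedFDeriv, h3, h2]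
  simp [L, iteratedFDeriv_comp_add_left]

end SeveralVariables

/-! ### Taylor coefficients of entire functions of one variable -/

section TaylorCoefficients

/-- The coefficient of degree `j` of the Taylor series at `0`. -/
noncomputable def taylorCoeff (h : ℂ → ℂ) (j : ℕ) : ℂ := (j.factorial : ℂ)⁻¹ * iteratedDeriv j h 0

theorem hasSum_taylorCoeff {h : ℂ → ℂ} (hh : Differentiable ℂ h) (t : ℂ) :
    HasSum (fun j => taylorCoeff h j * t ^ j) (h t) := by
  have := Complex.hasSum_taylorSeries_of_entire hh 0 t
  refine this.congr_fun fun j => ?_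
  simp [taylorCoeff]
  ring

/-- Cauchy's estimate with a mean over the circle in place of a supremum, since a mean can be
integrated against the Gaussian measure. For `j = 0` it is the sub-mean-value property. -/
theorem norm_taylorCoeff_mul_pow_le {h : ℂ → ℂ} (hh : Differentiable ℂ h) {r : ℝ} (hr : 0 < r)
    (j : ℕ) : ‖taylorCoeff h j‖ * r ^ j ≤
      (2 * Real.pi)⁻¹ * ∫ θ in (0 : ℝ)..2 * Real.pi, ‖h (circleMap 0 r θ)‖ := by
  lift r to NNReal using hr.le
  have h1 : HasFPowerSeriesOnBall h (cauchyPowerSeries h 0 r) 0 r :=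
    hh.differentiableOn.hasFPowerSeriesOnBall (by exact_mod_cast hr)
  have h2 := h1.factorial_smul 1 j
  have h3 : taylorCoeff h j = cauchyPowerSeries h 0 r j fun _ => 1 := by
    rw [taylorCoeff, iteratedDeriv_eq_iteratedFDeriv, ← h2, nsmul_eq_mul, ← mul_assoc,
      inv_mul_cancel₀ (by exact_mod_cast j.factorial_ne_zero), one_mul]
  have h4 : ‖taylorCoeff h j‖ ≤ ‖cauchyPowerSeries h 0 r j‖ := by
    rw [h3]
    simpa only [norm_one, Finset.prod_const_one, mul_one] using
      (cauchyPowerSeries h 0 r j).le_opNorm fun _ => 1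
  have h5 := h4.trans (norm_cauchyPowerSeries_le h 0 r j)
  rw [abs_of_pos hr, inv_pow] at h5
  have h6 : (0 : ℝ) < (r : ℝ) ^ j := by positivity
  calc _ ≤ _ := mul_le_mul_of_nonneg_right h5 h6.le
    _ = _ := by rw [mul_assoc, inv_mul_cancel₀ h6.ne', mul_one]

theorem taylorCoeff_eq_of_forall_hasSum {h : ℂ → ℂ} {a : ℕ → ℂ}
    (ha : ∀ t, HasSum (fun j => a j * t ^ j) (h t)) (j : ℕ) : taylorCoeff h j = a j := by
  have hp : HasFPowerSeriesOnBall h (FormalMultilinearSeries.ofScalars ℂ a) 0 ⊤ := by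
    refine ⟨?_, by simp, fun {y} _ => ?_⟩
    · refine top_le_iff.2 (FormalMultilinearSeries.radius_eq_top_of_summable_norm _ fun r => ?_)
      have := (ha r).summable.norm
      simpa [FormalMultilinearSeries.ofScalars_norm] using this
    · have := ha y
      simpa [mul_comm] using this
  have h2 := hp.factorial_smul 1 j
  rw [taylorCoeff, iteratedDeriv_eq_iteratedFDeriv, ← h2, nsmul_eq_mul, ← mul_assoc,
    inv_mul_cancel₀ (by exact_mod_cast j.factorial_ne_zero), one_mul]
  simp

theorem taylorCoeff_comp_mul_left {h : ℂ → ℂ} (hh : Differentiable ℂ h) (s : ℂ) (j : ℕ) :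
    taylorCoeff (fun t => h (s * t)) j = s ^ j * taylorCoeff h j := by
  refine taylorCoeff_eq_of_forall_hasSum (a := fun j => s ^ j * taylorCoeff h j) (fun t => ?_) j
  refine (hasSum_taylorCoeff hh (s * t)).congr_fun fun i => ?_
  ring

theorem taylorCoeff_pow_mul_const (i j : ℕ) (c : ℂ) :
    taylorCoeff (fun t => t ^ i * c) j = if j = i then c else 0 := by
  refine taylorCoeff_eq_of_forall_hasSum (a := fun j => if j = i then c else 0) (fun t => ?_) j
  have := hasSum_ite_eq i (t ^ i * c)
  refine this.congr_fun fun k => ?_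
  split_ifs with hk
  · rw [hk, mul_comm]
  · simp

/-- At half the radius, Cauchy's estimate makes the tail of the Taylor series geometric with ratio
`1 / 2`. -/
theorem norm_sub_sum_taylorCoeff_le {h : ℂ → ℂ} (hh : Differentiable ℂ h) {r : ℝ} (hr : 0 < r)
    {t : ℂ} (ht : ‖t‖ ≤ r / 2) (m : ℕ) :
    ‖h t - ∑ j ∈ Finset.range m, t ^ j * taylorCoeff h j‖ ≤ 2 * (2⁻¹) ^ m *
      ((2 * Real.pi)⁻¹ * ∫ θ in (0 : ℝ)..2 * Real.pi, ‖h (circleMap 0 r θ)‖) := by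
  set I := (2 * Real.pi)⁻¹ * ∫ θ in (0 : ℝ)..2 * Real.pi, ‖h (circleMap 0 r θ)‖
  have h1 := (hasSum_nat_add_iff' m).2 (hasSum_taylorCoeff hh t)
  have hgeo : HasSum (fun j : ℕ => (2⁻¹ : ℝ) ^ m * I * (2⁻¹) ^ j) ((2⁻¹ : ℝ) ^ m * I * 2) := by
    have := hasSum_geometric_two.mul_left ((2⁻¹ : ℝ) ^ m * I)
    simpa using this
  have hb : ∀ j, ‖taylorCoeff h (j + m) * t ^ (j + m)‖ ≤ (2⁻¹ : ℝ) ^ m * I * (2⁻¹) ^ j := by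
    intro j
    rw [norm_mul, norm_pow]
    calc ‖taylorCoeff h (j + m)‖ * ‖t‖ ^ (j + m)
        ≤ ‖taylorCoeff h (j + m)‖ * (r / 2) ^ (j + m) := by gcongr
      _ = (‖taylorCoeff h (j + m)‖ * r ^ (j + m)) * (2⁻¹) ^ (j + m) := by
        rw [div_eq_mul_inv, mul_pow, mul_assoc]
      _ ≤ I * (2⁻¹) ^ (j + m) := by
        gcongr
        exact norm_taylorCoeff_mul_pow_le hh hr (j + m)
      _ = _ := by rw [pow_add]; ring
  have h2 := h1.norm_le_of_bounded hgeo hb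
  have h3 : ∑ j ∈ Finset.range m, t ^ j * taylorCoeff h j =
      ∑ j ∈ Finset.range m, taylorCoeff h j * t ^ j := Finset.sum_congr rfl fun _ _ => mul_comm _ _
  rw [h3]
  linarith

end TaylorCoefficients

/-! ### Gaussian integrals and the averaging estimate -/

section FockEnergy

variable {n : ℕ}

/-- The Gaussian weight, the density of `fockMeasure`. -/
noncomputable def gaussWeight (n : ℕ) (z : CSpace n) : ℝ :=
  ((2 * Real.pi) ^ n)⁻¹ * Real.exp (-(‖z‖ ^ 2 / 2))

theorem gaussWeight_nonneg (z : CSpace n) : 0 ≤ gaussWeight n z := by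
  unfold gaussWeight
  positivity

theorem continuous_gaussWeight : Continuous (gaussWeight n) := by
  unfold gaussWeight
  fun_prop

theorem measurable_ofReal_gaussWeight :
    Measurable fun z : CSpace n => ENNReal.ofReal (gaussWeight n z) :=
  continuous_gaussWeight.measurable.ennreal_ofReal

theorem lintegral_fockMeasure {h : CSpace n → ℝ≥0∞} (hh : Measurable h) :
    ∫⁻ z, h z ∂(fockMeasure n) = ∫⁻ z, ENNReal.ofReal (gaussWeight n z) * h z :=
  lintegral_withDensity_eq_lintegral_mul _ measurable_ofReal_gaussWeight hh

theorem integrable_exp_neg_mul_sq_norm {b : ℝ} (hb : 0 < b) :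
    Integrable (fun z : CSpace n => Real.exp (-b * ‖z‖ ^ 2)) := by
  have := (GaussianFourier.integrable_cexp_neg_mul_sq_norm_add (V := CSpace n) (b := (b : ℂ))
    (by simpa using hb) 0 0).norm
  refine this.congr (Filter.Eventually.of_forall fun z => ?_)
  simp only [Complex.norm_exp]
  congr 1
  simp [← Complex.ofReal_pow]

theorem mem_fockSubmodule_iff {f : CSpace n → ℂ} : f ∈ fockSubmodule n ↔
    Differentiable ℂ f ∧ ∫⁻ z, ‖f z‖ₑ ^ 2 ∂(fockMeasure n) < ∞ := by
  change (Differentiable ℂ f ∧ MemLp f 2 (fockMeasure n)) ↔ _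
  refine and_congr_right fun hf => ?_
  rw [MemLp, and_iff_right hf.continuous.aestronglyMeasurable,
    eLpNorm_lt_top_iff_lintegral_rpow_enorm_lt_top two_ne_zero ENNReal.ofNat_ne_top]
  simp

theorem Fock.enorm_sq_eq (f : Fock n) : ‖f‖ₑ ^ 2 = ∫⁻ z, ‖f z‖ₑ ^ 2 ∂(fockMeasure n) := by
  have h1 : ‖f‖ₑ = eLpNorm f 2 (fockMeasure n) := Lp.enorm_toLp f.memLp
  have h2 := eLpNorm_nnreal_pow_eq_lintegral (f := f) (μ := fockMeasure n) (p := 2) two_ne_zero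
  rw [h1]
  simpa using h2

theorem Fock.norm_le_of_enorm_sq_le {f g : Fock n} {c : ℝ} (hc : 0 ≤ c)
    (h : ∫⁻ z, ‖g z‖ₑ ^ 2 ∂(fockMeasure n) ≤
      ENNReal.ofReal (c ^ 2) * ∫⁻ z, ‖f z‖ₑ ^ 2 ∂(fockMeasure n)) : ‖g‖ ≤ c * ‖f‖ := by
  rw [← Fock.enorm_sq_eq, ← Fock.enorm_sq_eq, ← ofReal_norm, ← ofReal_norm,
    ← ENNReal.ofReal_pow (norm_nonneg _), ← ENNReal.ofReal_pow (norm_nonneg _),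
    ← ENNReal.ofReal_mul (by positivity), ENNReal.ofReal_le_ofReal_iff (by positivity),
    ← mul_pow] at h
  exact (sq_le_sq₀ (norm_nonneg _) (by positivity)).1 h

theorem measurable_enorm_sq {f : CSpace n → ℂ} (hf : Differentiable ℂ f) :
    Measurable fun z => ‖f z‖ₑ ^ 2 :=
  (hf.continuous.measurable.enorm).pow_const 2

theorem mem_fockSubmodule_of_norm_le_exp {f : CSpace n → ℂ} (hf : Differentiable ℂ f) {c : ℝ}
    (hc : ∀ z, ‖f z‖ ≤ c * Real.exp (‖z‖ ^ 2 / 8)) : f ∈ fockSubmodule n := by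
  refine mem_fockSubmodule_iff.2 ⟨hf, ?_⟩
  rw [lintegral_fockMeasure (measurable_enorm_sq hf)]
  -- Squaring `exp (‖z‖² / 8)` uses up half of the Gaussian exponent `1 / 2`, leaving the integrable
  -- factor `exp (-‖z‖² / 4)`.
  have hi := ((integrable_exp_neg_mul_sq_norm (n := n) (b := 1 / 4) (by norm_num)).const_mul
    (((2 * Real.pi) ^ n)⁻¹ * c ^ 2)).lintegral_lt_top
  refine lt_of_le_of_lt (lintegral_mono fun z => ?_) hi
  rw [← ofReal_norm, ← ENNReal.ofReal_pow (norm_nonneg _),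
    ← ENNReal.ofReal_mul (gaussWeight_nonneg z)]
  refine ENNReal.ofReal_le_ofReal ?_
  have h1 : ‖f z‖ ^ 2 ≤ (c * Real.exp (‖z‖ ^ 2 / 8)) ^ 2 :=
    pow_le_pow_left₀ (norm_nonneg _) (hc z) 2
  refine (mul_le_mul_of_nonneg_left h1 (gaussWeight_nonneg z)).trans_eq ?_
  have h2 : Real.exp (-(1 / 4) * ‖z‖ ^ 2) =
      Real.exp (-(‖z‖ ^ 2 / 2)) * Real.exp (‖z‖ ^ 2 / 8) ^ 2 := by
    rw [← Real.exp_nat_mul, ← Real.exp_add]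
    congr 1
    push_cast
    ring
  rw [h2, gaussWeight]
  ring

theorem const_mem_fockSubmodule (c : ℂ) : (fun _ : CSpace n => c) ∈ fockSubmodule n :=
  mem_fockSubmodule_of_norm_le_exp (differentiable_const c) (c := ‖c‖) fun z =>
    le_mul_of_one_le_right (norm_nonneg _) (Real.one_le_exp (by positivity))

instance isFiniteMeasure_fockMeasure : IsFiniteMeasure (fockMeasure n) := by
  have := (mem_fockSubmodule_iff.1 (const_mem_fockSubmodule (n := n) 1)).2
  exact ⟨by simpa using this⟩

/-- The hypothesis on `c` bounds the ratio of the Gaussian weights at `z` and at `a + L z` by `exp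
(c / 2)`; the rest is the linear change of variables. -/
theorem lintegral_comp_affine_le {h : CSpace n → ℝ≥0∞} (hh : Measurable h) (a : CSpace n)
    (L : CSpace n →L[ℝ] CSpace n) (hL : L.det ≠ 0) {c : ℝ}
    (hc : ∀ z, ‖a + L z‖ ^ 2 ≤ ‖z‖ ^ 2 + c) :
    ∫⁻ z, h (a + L z) ∂(fockMeasure n) ≤
      ENNReal.ofReal (Real.exp (c / 2) * |L.det⁻¹|) * ∫⁻ z, h z ∂(fockMeasure n) := by
  have hm : Measurable fun z => a + L z := by fun_prop
  set k : CSpace n → ℝ≥0∞ := fun z => ENNReal.ofReal (gaussWeight n z) * h z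
  have hk : Measurable k := measurable_ofReal_gaussWeight.mul hh
  have h1 : ∫⁻ z, k (a + L z) = ENNReal.ofReal |L.det⁻¹| * ∫⁻ z, k z := by
    have h2 := Measure.map_linearMap_addHaar_eq_smul_addHaar (volume : Measure (CSpace n))
      (f := (L : CSpace n →ₗ[ℝ] CSpace n)) hL
    have h3 : ∫⁻ z, k (a + L z) = ∫⁻ z, k (a + z) ∂(Measure.map L volume) :=
      (lintegral_map (hk.comp (measurable_const_add a)) L.continuous.measurable).symm
    rw [h3]
    erw [h2]
    rw [lintegral_smul_measure, lintegral_add_left_eq_self]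
    rfl
  rw [lintegral_fockMeasure (h := fun z => h (a + L z)) (hh.comp hm), lintegral_fockMeasure hh,
    ENNReal.ofReal_mul (Real.exp_pos _).le, mul_assoc, ← h1, 
    ← lintegral_const_mul' _ _ ENNReal.ofReal_ne_top]
  refine lintegral_mono fun z => ?_
  simp only [k]
  rw [← mul_assoc, ← ENNReal.ofReal_mul (Real.exp_pos _).le]
  gcongr
  rw [gaussWeight, gaussWeight, mul_left_comm, ← Real.exp_add]
  gcongr
  linarith [hc z]

theorem sq_lintegral_enorm_le {Ω : Type*} [MeasurableSpace Ω] {ν : Measure Ω}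
    [IsProbabilityMeasure ν] {f : Ω → ℂ} (hf : AEStronglyMeasurable f ν) :
    (∫⁻ x, ‖f x‖ₑ ∂ν) ^ 2 ≤ ∫⁻ x, ‖f x‖ₑ ^ 2 ∂ν := by
  have h1 := eLpNorm_le_eLpNorm_of_exponent_le (p := 1) (q := 2) one_le_two hf
  have h2 := eLpNorm_nnreal_pow_eq_lintegral (f := f) (μ := ν) (p := 2) two_ne_zero
  rw [eLpNorm_one_eq_lintegral_enorm] at h1
  refine (pow_le_pow_left₀ zero_le h1 2).trans_eq ?_
  simpa using h2

/-- Normalized Lebesgue measure on the parameter interval of the circle. -/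
noncomputable def circleParam : Measure ℝ :=
  ENNReal.ofReal (2 * Real.pi)⁻¹ • volume.restrict (Set.Ioc 0 (2 * Real.pi))

instance isProbabilityMeasure_circleParam : IsProbabilityMeasure circleParam := by
  refine ⟨?_⟩
  rw [circleParam, Measure.smul_apply, Measure.restrict_apply_univ, Real.volume_Ioc, smul_eq_mul,
    ← ENNReal.ofReal_mul (by positivity), sub_zero, inv_mul_cancel₀ (by positivity),
    ENNReal.ofReal_one]

theorem ofReal_circle_average {h : ℝ → ℂ} (hh : Continuous h) :
    ENNReal.ofReal ((2 * Real.pi)⁻¹ * ∫ θ in (0 : ℝ)..2 * Real.pi, ‖h θ‖) =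
      ∫⁻ θ, ‖h θ‖ₑ ∂circleParam := by
  rw [ENNReal.ofReal_mul (by positivity), circleParam, lintegral_smul_measure, smul_eq_mul,
    intervalIntegral.integral_of_le (by positivity), ofReal_integral_norm_eq_lintegral_enorm]
  exact (hh.integrableOn_Icc).mono_set Set.Ioc_subset_Icc_self

/-- A function dominated by an average of `f` along a compact family of affine maps lies in the
Fock space, with a norm dominated by that of `f`. -/
theorem exists_norm_le_of_circle_average (a : ℝ → CSpace n) (L : ℝ → CSpace n →L[ℂ] CSpace n)
    (ha : Continuous a) (hL : Continuous L) (hinj : ∀ θ, Function.Injective (L θ)) {c : ℝ}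
    (hc : ∀ θ z, ‖a θ + L θ z‖ ^ 2 ≤ ‖z‖ ^ 2 + c) :
    ∃ K : ℝ, 0 ≤ K ∧ ∀ (f : Fock n) (g : CSpace n → ℂ) (C : ℝ), Differentiable ℂ g → 0 ≤ C →
      (∀ z, ‖g z‖ ≤ C * ((2 * Real.pi)⁻¹ *
        ∫ θ in (0 : ℝ)..2 * Real.pi, ‖f (a θ + L θ z)‖)) →
      ∃ h : g ∈ fockSubmodule n, ‖Fock.mk g h‖ ≤ C * K * ‖f‖ := by
  set M : ℝ → CSpace n →L[ℝ] CSpace n := fun θ => (L θ).restrictScalars ℝ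
  have hM : Continuous M := (ContinuousLinearMap.continuous_restrictScalars ℝ).comp hL
  have hdet : ∀ θ, (M θ).det ≠ 0 := by
    intro θ h0
    have h1 := LinearMap.bot_lt_ker_of_det_eq_zero (f := (M θ : CSpace n →ₗ[ℝ] CSpace n)) h0
    exact h1.ne' (LinearMap.ker_eq_bot.2 (hinj θ))
  have hdc : Continuous fun θ => (M θ).det⁻¹ :=
    (ContinuousLinearMap.continuous_det.comp hM).inv₀ hdet
  -- Injectivity together with compactness of the parameter interval bounds all inverse Jacobians at
  -- once.
  obtain ⟨D, hD⟩ := (isCompact_Icc (a := (0 : ℝ)) (b := 2 * Real.pi)).exists_bound_of_continuousOn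
    hdc.continuousOn
  have hD0 : 0 ≤ D := (norm_nonneg _).trans (hD 0 ⟨le_rfl, by positivity⟩)
  set K := Real.sqrt (Real.exp (c / 2) * D)
  have hK2 : K ^ 2 = Real.exp (c / 2) * D := Real.sq_sqrt (by positivity)
  refine ⟨K, Real.sqrt_nonneg _, fun f g C hg hC hle => ?_⟩
  have hfc : Continuous f := f.differentiable.continuous
  have hjoint : Continuous fun q : CSpace n × ℝ => f (a q.2 + L q.2 q.1) :=
    hfc.comp ((ha.comp continuous_snd).add ((hL.comp continuous_snd).clm_apply continuous_fst))
  -- Cauchy–Schwarz on the circle moves the square inside the average; Tonelli then allows the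
  -- change of variables for each `θ` separately.
  have hpt : ∀ z, ‖g z‖ₑ ^ 2 ≤ ENNReal.ofReal (C ^ 2) *
      ∫⁻ θ, ‖f (a θ + L θ z)‖ₑ ^ 2 ∂circleParam := by
    intro z
    have hz : Continuous fun θ => f (a θ + L θ z) :=
      hjoint.comp (continuous_const.prodMk continuous_id)
    have h1 := ENNReal.ofReal_le_ofReal (hle z)
    rw [ofReal_norm, ENNReal.ofReal_mul hC, ofReal_circle_average hz] at h1
    calc ‖g z‖ₑ ^ 2 ≤ (ENNReal.ofReal C * ∫⁻ θ, ‖f (a θ + L θ z)‖ₑ ∂circleParam) ^ 2 := by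
          gcongr
      _ ≤ _ := by
        rw [mul_pow, ENNReal.ofReal_pow hC]
        gcongr
        exact sq_lintegral_enorm_le hz.aestronglyMeasurable
  have hmain : ∫⁻ z, ‖g z‖ₑ ^ 2 ∂(fockMeasure n) ≤
      ENNReal.ofReal ((C * K) ^ 2) * ∫⁻ z, ‖f z‖ₑ ^ 2 ∂(fockMeasure n) := by
    have hjm : Measurable fun q : CSpace n × ℝ => ‖f (a q.2 + L q.2 q.1)‖ₑ ^ 2 :=
      hjoint.measurable.enorm.pow_const 2
    calc ∫⁻ z, ‖g z‖ₑ ^ 2 ∂(fockMeasure n)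
        ≤ ∫⁻ z, ENNReal.ofReal (C ^ 2) * ∫⁻ θ, ‖f (a θ + L θ z)‖ₑ ^ 2 ∂circleParam
            ∂(fockMeasure n) := lintegral_mono hpt
      _ = ENNReal.ofReal (C ^ 2) * ∫⁻ θ, ∫⁻ z, ‖f (a θ + L θ z)‖ₑ ^ 2 ∂(fockMeasure n)
            ∂circleParam := by
        rw [lintegral_const_mul' _ _ ENNReal.ofReal_ne_top, lintegral_lintegral_swap]
        exact hjm.aemeasurable
      _ ≤ ENNReal.ofReal (C ^ 2) * ∫⁻ _θ, ENNReal.ofReal (Real.exp (c / 2) * D) *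
            ∫⁻ z, ‖f z‖ₑ ^ 2 ∂(fockMeasure n) ∂circleParam := by
        refine mul_le_mul_right (lintegral_mono_ae ?_) _
        have hae : ∀ᵐ θ ∂circleParam, θ ∈ Set.Ioc 0 (2 * Real.pi) :=
          Measure.ae_smul_measure (ae_restrict_mem measurableSet_Ioc) _
        filter_upwards [hae] with θ hθ
        refine (lintegral_comp_affine_le (measurable_enorm_sq f.differentiable) (a θ) (M θ)
          (hdet θ) (hc θ)).trans ?_
        gcongr
        exact hD θ ⟨hθ.1.le, hθ.2⟩
      _ = _ := by
        rw [lintegral_const, measure_univ, mul_one, mul_pow, hK2, ENNReal.ofReal_mul (sq_nonneg C),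
          mul_assoc]
  have hgm : g ∈ fockSubmodule n := by
    refine mem_fockSubmodule_iff.2 ⟨hg, hmain.trans_lt ?_⟩
    exact ENNReal.mul_lt_top ENNReal.ofReal_lt_top (mem_fockSubmodule_iff.1 f.mem).2
  exact ⟨hgm, Fock.norm_le_of_enorm_sq_le (mul_nonneg hC (Real.sqrt_nonneg _)) hmain⟩

end FockEnergy

/-! ### Point evaluations and completeness of the Fock space -/

section FockSpace

variable {n : ℕ}

namespace Fock

theorem add_apply (f g : Fock n) (z : CSpace n) : (f + g) z = f z + g z := rfl

theorem sub_apply (f g : Fock n) (z : CSpace n) : (f - g) z = f z - g z := rfl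

theorem smul_apply (c : ℂ) (f : Fock n) (z : CSpace n) : (c • f) z = c * f z := rfl

theorem zero_apply (z : CSpace n) : (0 : Fock n) z = 0 := rfl

/-- Evaluation at a point. -/
def eval (z : CSpace n) : Fock n →ₗ[ℂ] ℂ where
  toFun f := f z
  map_add' f g := add_apply f g z
  map_smul' c f := smul_apply c f z

theorem sum_apply {ι : Type*} (s : Finset ι) (f : ι → Fock n) (z : CSpace n) :
    (∑ i ∈ s, f i) z = ∑ i ∈ s, f i z :=
  map_sum (eval z) f s

end Fock

/-- These are the Weyl operators: the exponential factor compensates exactly for the effect of the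
translation on the Gaussian weight. They transport estimates at `0` to any point, and applied to `1`
they give the normalised kernels. -/
theorem exists_weighted_translate (f : Fock n) (w : CSpace n) :
    ∃ g : Fock n, ‖g‖ = ‖f‖ ∧ ∀ z, g z =
      f (z + w) * Complex.exp (-(inner ℂ w z) / 2 - (‖w‖ ^ 2 / 4 : ℝ)) := by
  set g : CSpace n → ℂ := fun z =>
    f (z + w) * Complex.exp (-(inner ℂ w z) / 2 - (‖w‖ ^ 2 / 4 : ℝ)) with hg
  have hi : Differentiable ℂ fun z : CSpace n => inner ℂ w z := (innerSL ℂ w).differentiable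
  have hi2 : Differentiable ℂ fun z : CSpace n => -(inner ℂ w z) / 2 :=
    by simpa only [div_eq_mul_inv] using hi.fun_neg.mul_const (2⁻¹ : ℂ)
  have hgd : Differentiable ℂ g :=
    (f.differentiable.comp (differentiable_id.add_const w)).mul (hi2.sub_const _).cexp
  have hen : ∫⁻ z, ‖g z‖ₑ ^ 2 ∂(fockMeasure n) = ∫⁻ z, ‖f z‖ₑ ^ 2 ∂(fockMeasure n) := by
    rw [lintegral_fockMeasure (measurable_enorm_sq hgd),
      lintegral_fockMeasure (measurable_enorm_sq f.differentiable),
      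
      ← lintegral_add_right_eq_self (fun z => ENNReal.ofReal (gaussWeight n z) * ‖f z‖ₑ ^ 2) w]
    refine lintegral_congr fun z => ?_
    have h1 : ∀ y : ℂ, ‖y‖ₑ ^ 2 = ENNReal.ofReal (‖y‖ ^ 2) := fun y => by
      rw [← ofReal_norm, ENNReal.ofReal_pow (norm_nonneg _)]
    rw [h1, h1, ← ENNReal.ofReal_mul (gaussWeight_nonneg _),
      ← ENNReal.ofReal_mul (gaussWeight_nonneg _)]
    congr 1
    have h2 : ‖z + w‖ ^ 2 = ‖z‖ ^ 2 + 2 * (inner ℂ w z).re + ‖w‖ ^ 2 := by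
      rw [add_comm z w, norm_add_sq (𝕜 := ℂ)]
      simp only [RCLike.re_to_complex]
      ring
    rw [hg, gaussWeight, gaussWeight, h2]
    simp only
    rw [norm_mul, mul_pow ‖f (z + w)‖, Complex.norm_exp, ← Real.exp_nat_mul]
    have h3 : Real.exp (-((‖z‖ ^ 2 + 2 * (inner ℂ w z).re + ‖w‖ ^ 2) / 2)) =
        Real.exp (-(‖z‖ ^ 2 / 2)) * Real.exp (((2 : ℕ) : ℝ) *
          (-(inner ℂ w z) / 2 - ((‖w‖ ^ 2 / 4 : ℝ) : ℂ)).re) := by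
      rw [← Real.exp_add]
      congr 1
      rw [Complex.sub_re, Complex.ofReal_re, Complex.div_ofNat_re, Complex.neg_re]
      push_cast
      ring
    rw [h3]
    ring
  have hgm : g ∈ fockSubmodule n :=
    mem_fockSubmodule_iff.2 ⟨hgd, hen ▸ (mem_fockSubmodule_iff.1 f.mem).2⟩
  refine ⟨Fock.mk g hgm, le_antisymm ?_ ?_, fun z => rfl⟩
  · simpa using Fock.norm_le_of_enorm_sq_le (f := f) (g := Fock.mk g hgm) zero_le_one
      (by
      rw [one_pow, ENNReal.ofReal_one, one_mul]
      exact hen.le)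
  · simpa using Fock.norm_le_of_enorm_sq_le (f := Fock.mk g hgm) (g := f) zero_le_one
      (by
      rw [one_pow, ENNReal.ofReal_one, one_mul]
      exact hen.ge)

/-- The constant function `1`. -/
def Fock.one (n : ℕ) : Fock n := Fock.mk (fun _ => 1) (const_mem_fockSubmodule 1)

theorem Fock.one_apply (z : CSpace n) : Fock.one n z = 1 := rfl

theorem Fock.norm_one_pos : 0 < ‖Fock.one n‖ := by
  refine norm_pos_iff.2 fun h => ?_
  have : Fock.one n 0 = (0 : Fock n) 0 := by rw [h]
  rw [Fock.one_apply, Fock.zero_apply] at this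
  exact one_ne_zero this

/-- The constant `f 0` is dominated by the mean of `f` over the rotations of any `z`, so the
averaging estimate applies to the constant function `f 0`. -/
theorem Fock.exists_norm_apply_zero_le : ∃ C : ℝ, 0 ≤ C ∧ ∀ f : Fock n, ‖f 0‖ ≤ C * ‖f‖ := by
  obtain ⟨K, hK, h⟩ := exists_norm_le_of_circle_average (n := n) (fun _ => 0)
    (fun θ => circleMap 0 1 θ • ContinuousLinearMap.id ℂ _) continuous_const
    ((continuous_circleMap 0 1).smul continuous_const)
    (fun θ x y hxy => by simpa using hxy)
    (c := 0) (fun θ z => by simp [norm_smul])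
  refine ⟨K / ‖Fock.one n‖, by positivity, fun f => ?_⟩
  obtain ⟨hm, hle⟩ := h f (fun _ => f 0) 1 (differentiable_const _) zero_le_one fun z => by
    have := norm_taylorCoeff_mul_pow_le (differentiable_comp_line f.differentiable 0 z) one_pos 0
    simpa [taylorCoeff] using this
  have h1 : Fock.mk (fun _ => f 0) hm = f 0 • Fock.one n := by
    refine DFunLike.ext _ _ fun z => ?_
    rw [Fock.smul_apply, Fock.one_apply, mul_one]
    rfl
  rw [h1, norm_smul, one_mul] at hle
  rw [div_mul_eq_mul_div, le_div_iff₀ Fock.norm_one_pos]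
  exact hle

theorem Fock.exists_norm_apply_le : ∃ C : ℝ, 0 ≤ C ∧
    ∀ (f : Fock n) (w : CSpace n), ‖f w‖ ≤ C * Real.exp (‖w‖ ^ 2 / 4) * ‖f‖ := by
  obtain ⟨C, hC, h⟩ := Fock.exists_norm_apply_zero_le (n := n)
  refine ⟨C, hC, fun f w => ?_⟩
  obtain ⟨g, hg, hgz⟩ := exists_weighted_translate f w
  have h1 := h g
  rw [hg, hgz] at h1
  simp only [zero_add, inner_zero_right, neg_zero, zero_div, zero_sub, norm_mul, Complex.norm_exp,
    Complex.neg_re, Complex.ofReal_re] at h1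
  rw [Real.exp_neg, mul_inv_le_iff₀ (Real.exp_pos _)] at h1
  linarith

/-- The pointwise bound makes a Cauchy sequence converge locally uniformly to a holomorphic
function, and Fatou's lemma upgrades this to convergence in norm. Completeness makes the bounded
operators a Banach algebra. -/
instance Fock.completeSpace : CompleteSpace (Fock n) := by
  refine Metric.complete_of_cauchySeq_tendsto fun u hu => ?_
  obtain ⟨C, hC, hpt⟩ := Fock.exists_norm_apply_le (n := n)
  rw [Metric.cauchySeq_iff] at hu
  have huc : ∀ r : ℝ, UniformCauchySeqOn (fun k z => u k z) Filter.atTop (Metric.closedBall 0 r) := by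
    intro r
    rw [Metric.uniformCauchySeqOn_iff]
    intro ε hε
    set c := C * Real.exp (r ^ 2 / 4) + 1
    have hc : 0 < c := by positivity
    obtain ⟨N, hN⟩ := hu (ε / c) (div_pos hε hc)
    refine ⟨N, fun k hk l hl z hz => ?_⟩
    have h1 := hN k hk l hl
    rw [dist_eq_norm] at h1 ⊢
    have h2 : Real.exp (‖z‖ ^ 2 / 4) ≤ Real.exp (r ^ 2 / 4) := by
      have : ‖z‖ ≤ r := by simpa using hz
      gcongr
    calc ‖u k z - u l z‖ ≤ C * Real.exp (‖z‖ ^ 2 / 4) * ‖u k - u l‖ := hpt (u k - u l) z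
      _ ≤ c * ‖u k - u l‖ := by
        refine mul_le_mul_of_nonneg_right ?_ (norm_nonneg _)
        exact (mul_le_mul_of_nonneg_left h2 hC).trans (by simp [c])
      _ < c * (ε / c) := by gcongr
      _ = ε := by field_simp
  have hlim : ∀ z, ∃ y, Filter.Tendsto (fun k => u k z) Filter.atTop (nhds y) := fun z =>
    cauchySeq_tendsto_of_complete ((huc ‖z‖).cauchySeq (x := z) (by simp))
  choose g hg using hlim
  have hgd : Differentiable ℂ g := differentiable_of_tendstoUniformlyOn_closedBall
    (fun k => (u k).differentiable) fun r =>
      (huc r).tendstoUniformlyOn_of_tendsto fun z _ => hg z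
  have hkey : ∀ ε : ℝ, 0 < ε → ∃ N, ∀ k ≥ N,
      ∫⁻ z, ‖g z - u k z‖ₑ ^ 2 ∂(fockMeasure n) ≤ ENNReal.ofReal ε ^ 2 := by
    intro ε hε
    obtain ⟨N, hN⟩ := hu ε hε
    refine ⟨N, fun k hk => ?_⟩
    have h1 : ∀ z, ‖g z - u k z‖ₑ ^ 2 =
        Filter.liminf (fun l => ‖u l z - u k z‖ₑ ^ 2) Filter.atTop := fun z =>
      (((ENNReal.continuous_pow 2).comp continuous_enorm).tendsto _ |>.comp
        ((hg z).sub_const (u k z))).liminf_eq.symm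
    simp_rw [h1]
    refine (lintegral_liminf_le fun l => measurable_enorm_sq (u l - u k).differentiable).trans ?_
    refine Filter.liminf_le_of_frequently_le' (Filter.Eventually.frequently ?_)
    filter_upwards [Filter.eventually_ge_atTop N] with l hl
    rw [← Fock.enorm_sq_eq, ← ofReal_norm, ← dist_eq_norm]
    gcongr
    exact (hN l hl k hk).le
  have hsub : ∀ ε : ℝ, 0 < ε → ∃ N, ∀ k ≥ N, ∃ h : (fun z => g z - u k z) ∈ fockSubmodule n,
      ‖Fock.mk _ h‖ ≤ ε := by
    intro ε hε
    obtain ⟨N, hN⟩ := hkey ε hε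
    refine ⟨N, fun k hk => ?_⟩
    have hm : (fun z => g z - u k z) ∈ fockSubmodule n :=
      mem_fockSubmodule_iff.2 ⟨hgd.sub (u k).differentiable,
        (hN k hk).trans_lt (ENNReal.pow_lt_top ENNReal.ofReal_lt_top)⟩
    refine ⟨hm, ?_⟩
    have h1 : ‖Fock.mk _ hm‖ₑ ^ 2 ≤ ENNReal.ofReal ε ^ 2 := by
      rw [Fock.enorm_sq_eq]
      exact hN k hk
    have h2 := (ENNReal.pow_le_pow_left_iff two_ne_zero).1 h1
    rwa [← ofReal_norm, ENNReal.ofReal_le_ofReal_iff hε.le] at h2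
  obtain ⟨N, hN⟩ := hsub 1 one_pos
  obtain ⟨hm, -⟩ := hN N le_rfl
  have hgm : g ∈ fockSubmodule n := by
    have := (fockSubmodule n).add_mem hm (u N).mem
    convert this using 1
    ext z
    simp
  refine ⟨Fock.mk g hgm, Metric.tendsto_atTop.2 fun ε hε => ?_⟩
  obtain ⟨M, hM⟩ := hsub (ε / 2) (half_pos hε)
  refine ⟨M, fun k hk => ?_⟩
  obtain ⟨hmk, hle⟩ := hM k hk
  rw [dist_comm, dist_eq_norm]
  exact hle.trans_lt (half_lt_self hε)

end FockSpace

/-! ### Growth of the symbol and affineness -/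

section AffineSymbol

variable {n : ℕ}

theorem exists_norm_sq_le_of_boundedComposition {φ : CSpace n → CSpace n}
    (hb : BoundedComposition φ) : ∃ c : ℝ, 0 ≤ c ∧ ∀ w, ‖φ w‖ ^ 2 ≤ ‖w‖ ^ 2 + c := by
  obtain ⟨C, hC, hpt⟩ := Fock.exists_norm_apply_le (n := n)
  set T := compositionOperator φ hb
  set K := C * (‖T‖ * ‖Fock.one n‖) + 1 with hK
  have hK1 : 1 ≤ K := by
    rw [hK]
    linarith [show 0 ≤ C * (‖T‖ * ‖Fock.one n‖) by positivity]
  refine ⟨4 * Real.log K, mul_nonneg (by norm_num) (Real.log_nonneg hK1), fun w => ?_⟩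
  -- `g` is a multiple of the reproducing kernel at `φ w`, of norm independent of `w`, and `T g w =
  -- exp (‖φ w‖² / 4)`; comparison with the bound for evaluation at `w` gives the claim.
  obtain ⟨g, hg, hgz⟩ := exists_weighted_translate (Fock.one n) (-φ w)
  have h1 := hpt (T g) w
  have h2 : ‖T g‖ ≤ ‖T‖ * ‖Fock.one n‖ := hg ▸ T.le_opNorm g
  have h3 : ‖T g w‖ = Real.exp (‖φ w‖ ^ 2 / 4) := by
    change ‖g (φ w)‖ = _
    rw [hgz, Fock.one_apply, one_mul, Complex.norm_exp]
    congr 1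
    rw [inner_neg_left, neg_neg, norm_neg, inner_self_eq_norm_sq_to_K, Complex.sub_re,
      Complex.ofReal_re, Complex.div_ofNat_re]
    have : ((((‖φ w‖ : ℝ) : ℂ)) ^ 2).re = ‖φ w‖ ^ 2 := by
      rw [← Complex.ofReal_pow, Complex.ofReal_re]
    erw [this]
    ring
  have h4 : Real.exp (‖φ w‖ ^ 2 / 4) ≤ Real.exp (‖w‖ ^ 2 / 4) * K := by
    rw [← h3]
    refine h1.trans ?_
    calc C * Real.exp (‖w‖ ^ 2 / 4) * ‖T g‖
        ≤ C * Real.exp (‖w‖ ^ 2 / 4) * (‖T‖ * ‖Fock.one n‖) := by gcongr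
      _ = Real.exp (‖w‖ ^ 2 / 4) * (C * (‖T‖ * ‖Fock.one n‖)) := by ring
      _ ≤ _ := by
        gcongr
        rw [hK]
        linarith
  have h5 : Real.exp (‖φ w‖ ^ 2 / 4) ≤ Real.exp (‖w‖ ^ 2 / 4 + Real.log K) := by
    rwa [Real.exp_add, Real.exp_log (by linarith)]
  linarith [Real.exp_le_exp.1 h5]

theorem norm_le_add_sqrt {x y c : ℝ} (hx : 0 ≤ x) (hc : 0 ≤ c) (h : y ^ 2 ≤ x ^ 2 + c) :
    y ≤ x + Real.sqrt c := by
  refine le_of_abs_le (abs_le_of_sq_le_sq (h.trans ?_) (by positivity))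
  nlinarith [Real.sq_sqrt hc, Real.sqrt_nonneg c]

/-- On each complex line through `0`, Cauchy's estimate on a disc of radius `‖t‖ + 1` bounds the
derivative uniformly, so it is constant by Liouville's theorem. -/
theorem eq_add_fderiv_of_norm_le_add {F : Type*} [NormedAddCommGroup F] [NormedSpace ℂ F]
    [CompleteSpace F] {φ : F → F} (hφ : Differentiable ℂ φ) {c : ℝ} (hc : 0 ≤ c)
    (h : ∀ z, ‖φ z‖ ≤ ‖z‖ + c) (z : F) : φ z = fderiv ℂ φ 0 z + φ 0 := by
  set k : ℂ → F := fun t => φ (t • z) with hk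
  have hkd : Differentiable ℂ k := hφ.comp (differentiable_id.smul_const z)
  have hbound : ∀ t, ‖deriv k t‖ ≤ 2 * ‖z‖ + c := by
    intro t
    have h1 := Complex.norm_deriv_le_of_forall_mem_sphere_norm_le (c := t) (R := ‖t‖ + 1)
      (C := (‖t‖ + 1) * (2 * ‖z‖ + c)) (f := k) (by positivity) hkd.diffContOnCl ?_
    · rwa [mul_div_assoc, mul_div_cancel₀ _ (by positivity)] at h1
    · intro s hs
      have hs1 : ‖s - t‖ = ‖t‖ + 1 := by simpa [dist_eq_norm] using hs
      have hs2 : ‖s‖ ≤ 2 * ‖t‖ + 1 := by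
        calc ‖s‖ = ‖(s - t) + t‖ := by rw [sub_add_cancel]
          _ ≤ ‖s - t‖ + ‖t‖ := norm_add_le _ _
          _ = _ := by rw [hs1]; ring
      have h2 := h (s • z)
      rw [norm_smul] at h2
      have h3 : ‖s‖ * ‖z‖ ≤ (2 * ‖t‖ + 1) * ‖z‖ := by gcongr
      nlinarith [norm_nonneg z, norm_nonneg t, mul_nonneg (norm_nonneg t) hc]
  have hdd : Differentiable ℂ (deriv k) := fun t =>
    (hkd.analyticAt t).deriv.differentiableAt
  have hconst : ∀ t, deriv k t = deriv k 0 := fun t =>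
    hdd.apply_eq_apply_of_bounded
      (isBounded_iff_forall_norm_le.2 ⟨_, by rintro _ ⟨t, rfl⟩; exact hbound t⟩) t 0
  have h0 : deriv k 0 = fderiv ℂ φ 0 z := by
    have h1 : HasDerivAt (fun t : ℂ => t • z) z 0 := by
      simpa using (hasDerivAt_id (0 : ℂ)).smul_const z
    have h2 : HasFDerivAt φ (fderiv ℂ φ 0) ((0 : ℂ) • z) := by
      rw [zero_smul]
      exact (hφ 0).hasFDerivAt
    exact (h2.comp_hasDerivAt 0 h1).deriv
  have hlin : ∀ t, HasDerivAt (fun t : ℂ => k t - t • deriv k 0) 0 t := by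
    intro t
    have h1 := (hkd t).hasDerivAt.sub ((hasDerivAt_id t).smul_const (deriv k 0))
    simp only [hconst t, one_smul, sub_self] at h1
    exact h1
  have h1 := is_const_of_deriv_eq_zero (fun t => (hlin t).differentiableAt)
    (fun t => (hlin t).deriv) 1 0
  simp only [one_smul, zero_smul, sub_zero] at h1
  rw [← h0]
  simpa [hk] using sub_eq_iff_eq_add'.1 h1

end AffineSymbol

/-! ### Orthogonal splitting of a contraction -/

section Contraction

variable {E : Type*} [NormedAddCommGroup E] [InnerProductSpace ℂ E]

theorem eq_zero_of_forall_re_conj_mul_le {d : ℂ} {c : ℝ}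
    (h : ∀ t : ℂ, (starRingEnd ℂ t * d).re ≤ c) : d = 0 := by
  by_contra hd
  have hd' : 0 < Complex.normSq d := Complex.normSq_pos.2 hd
  have := h ((((c + 1) / Complex.normSq d : ℝ) : ℂ) * d)
  rw [map_mul, mul_assoc, ← Complex.normSq_eq_conj_mul_self, Complex.conj_ofReal,
    ← Complex.ofReal_mul, Complex.ofReal_re, div_mul_cancel₀ _ hd'.ne'] at this
  linarith

theorem norm_smul_add_sq (t : ℂ) (x y : E) : ‖t • x + y‖ ^ 2 =
    ‖t‖ ^ 2 * ‖x‖ ^ 2 + 2 * (starRingEnd ℂ t * inner ℂ x y).re + ‖y‖ ^ 2 := by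
  rw [norm_add_sq (𝕜 := ℂ), inner_smul_left, norm_smul, mul_pow]
  rfl

/-- After the quadratic terms cancel, a real-linear function of `t` is bounded above, hence zero. -/
theorem inner_eq_zero_of_norm_sq_le {x b : E} {c : ℝ}
    (h : ∀ t : ℂ, ‖t • x + b‖ ^ 2 ≤ ‖t • x‖ ^ 2 + c) : inner ℂ x b = 0 := by
  refine eq_zero_of_forall_re_conj_mul_le (c := c / 2) fun t => ?_
  have := h t
  rw [norm_smul_add_sq, norm_smul, mul_pow] at this
  nlinarith [sq_nonneg ‖b‖]

/-- Expanding `‖A (t • x + y)‖² ≤ ‖t • x + y‖²`, the terms quadratic in `t` cancel by `hx`, and the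
linear term is bounded above in `t`, so it vanishes. Only `x` need keep its norm. -/
theorem inner_map_map_of_norm_eq {A : E →L[ℂ] E} (hA : ∀ x, ‖A x‖ ≤ ‖x‖) {x : E}
    (hx : ‖A x‖ = ‖x‖) (y : E) : inner ℂ (A x) (A y) = inner ℂ x y := by
  refine sub_eq_zero.1 (eq_zero_of_forall_re_conj_mul_le (c := ‖y‖ ^ 2 / 2) fun t => ?_)
  have h1 := pow_le_pow_left₀ (norm_nonneg _) (hA (t • x + y)) 2
  rw [map_add, map_smul, norm_smul_add_sq, norm_smul_add_sq, hx] at h1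
  rw [mul_sub, Complex.sub_re]
  nlinarith [sq_nonneg ‖A y‖]

/-- The eigenvectors for the eigenvalues of modulus one. -/
def unimodularEigenvectors (A : E →L[ℂ] E) : Set E := {x | ∃ l : ℂ, ‖l‖ = 1 ∧ A x = l • x}

/-- The orthogonal splitting of a contraction into a unitary part, on the range of `U`, and a part
without eigenvalues of modulus one, on the range of `V`. -/
structure ContractionSplitting (A U V : E →L[ℂ] E) : Prop where
  add_eq_one : U + V = 1
  comp_self : ∀ x, U (U x) = U x
  comm : ∀ x, A (U x) = U (A x)
  inner_eq_zero : ∀ x y, inner ℂ (U x) (V y) = 0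
  norm_map : ∀ x, ‖A (U x)‖ = ‖U x‖
  map_eigenvector : ∀ x ∈ unimodularEigenvectors A, U x = x
  mem_span : ∀ x, U x ∈ Submodule.span ℂ (unimodularEigenvectors A)

/-- `U` is the orthogonal projection onto the span of the unimodular eigenvectors. Since `A`
preserves inner products against this span, the orthogonal complement is invariant too, and so `U`
commutes with `A`. -/
theorem exists_contractionSplitting [FiniteDimensional ℂ E] {A : E →L[ℂ] E}
    (hA : ∀ x, ‖A x‖ ≤ ‖x‖) : ∃ U V, ContractionSplitting A U V := by
  set S := Submodule.span ℂ (unimodularEigenvectors A) with hS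
  have hgen : ∀ x ∈ unimodularEigenvectors A, ‖A x‖ = ‖x‖ := by
    rintro x ⟨l, hl, hx⟩
    rw [hx, norm_smul, hl, one_mul]
  have hinner : ∀ x ∈ S, ∀ y, inner ℂ (A x) (A y) = inner ℂ x y := by
    intro x hx y
    induction hx using Submodule.span_induction with
    | mem x hx => exact inner_map_map_of_norm_eq hA (hgen x hx) y
    | zero => simp
    | add x z _ _ h1 h2 => rw [map_add, inner_add_left, inner_add_left, h1, h2]
    | smul c x _ h1 => rw [map_smul, inner_smul_left, inner_smul_left, h1]
  have hnorm : ∀ x ∈ S, ‖A x‖ = ‖x‖ := by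
    intro x hx
    have h1 := hinner x hx x
    rw [inner_self_eq_norm_sq_to_K, inner_self_eq_norm_sq_to_K] at h1
    have h2 : ‖A x‖ ^ 2 = ‖x‖ ^ 2 := by exact_mod_cast h1
    exact (sq_eq_sq₀ (norm_nonneg _) (norm_nonneg _)).1 h2
  have hmap : ∀ x ∈ S, A x ∈ S := by
    intro x hx
    induction hx using Submodule.span_induction with
    | mem x hx =>
      have hx' : x ∈ S := Submodule.subset_span hx
      obtain ⟨l, _, hl⟩ := hx
      rw [hl]
      exact S.smul_mem l hx'
    | zero => simp
    | add x z _ _ h1 h2 => rw [map_add]; exact S.add_mem h1 h2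
    | smul c x _ h1 => rw [map_smul]; exact S.smul_mem c h1
  have hperp : ∀ y ∈ Sᗮ, A y ∈ Sᗮ := by
    intro y hy
    rw [Submodule.mem_orthogonal]
    intro x hx
    induction hx using Submodule.span_induction with
    | mem x hx =>
      have hx' : x ∈ S := Submodule.subset_span hx
      obtain ⟨l, hl, hxl⟩ := hx
      have hl0 : l ≠ 0 := by
        rintro rfl
        simp at hl
      have h1 := hinner x hx' y
      rw [hxl, inner_smul_left, (Submodule.mem_orthogonal S y).1 hy x hx'] at h1
      exact (mul_eq_zero.1 h1).resolve_left (by simpa using hl0)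
    | zero => simp
    | add x z _ _ h1 h2 => rw [inner_add_left, h1, h2, add_zero]
    | smul c x _ h1 => rw [inner_smul_left, h1, mul_zero]
  have hU : ∀ x, S.starProjection x ∈ S := fun x => Submodule.starProjection_apply_mem S x
  have hV : ∀ x, x - S.starProjection x ∈ Sᗮ := fun x => Submodule.sub_starProjection_mem_orthogonal x
  have hUS : ∀ x ∈ S, S.starProjection x = x := fun x hx =>
    Submodule.starProjection_eq_self_iff.2 hx
  refine ⟨S.starProjection, 1 - S.starProjection, by abel, fun x => hUS _ (hU x), fun x => ?_,
    fun x y => (Submodule.mem_orthogonal S _).1 (hV y) _ (hU x), fun x => hnorm _ (hU x),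
    fun x hx => hUS x (Submodule.subset_span hx), hU⟩
  refine (Submodule.eq_starProjection_of_mem_of_inner_eq_zero (hmap _ (hU x)) fun w hw => ?_).symm
  rw [← map_sub]
  exact inner_eq_zero_symm.1 ((Submodule.mem_orthogonal S _).1 (hperp _ (hV x)) w hw)

end Contraction

/-! ### Decay of powers and eigenvalues -/

section SpectralDecay

/-- Gelfand's formula: the spectral radius is below some `r < 1`, so eventually `‖a ^ k‖ < r ^ k`.
-/
theorem tendsto_norm_pow_of_spectrum_lt_one {R : Type*} [NormedRing R] [NormedAlgebra ℂ R]
    [CompleteSpace R] {a : R} (ha : ∀ μ ∈ spectrum ℂ a, ‖μ‖ < 1) :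
    Filter.Tendsto (fun k : ℕ => ‖a ^ k‖) Filter.atTop (nhds 0) := by
  nontriviality R
  have h1 : spectralRadius ℂ a < ((1 : NNReal) : ℝ≥0∞) :=
    spectrum.spectralRadius_lt_of_forall_lt a ha
  obtain ⟨r, hr, hr1⟩ := ENNReal.lt_iff_exists_nnreal_btwn.1 h1
  have hr1' : (r : ℝ) < 1 := by exact_mod_cast hr1
  have h2 := (spectrum.pow_nnnorm_pow_one_div_tendsto_nhds_spectralRadius a).eventually_lt_const hr
  refine squeeze_zero' (Filter.Eventually.of_forall fun k => norm_nonneg _) ?_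
    (tendsto_pow_atTop_nhds_zero_of_lt_one r.2 hr1')
  filter_upwards [h2, Filter.eventually_gt_atTop 0] with k hk hk0
  have hk0' : (0 : ℝ) < k := by exact_mod_cast hk0
  have h3 : (‖a ^ k‖₊ : ℝ≥0∞) < (r : ℝ≥0∞) ^ k := by
    have h4 := ENNReal.rpow_lt_rpow hk hk0'
    rwa [← ENNReal.rpow_mul, one_div, inv_mul_cancel₀ hk0'.ne', ENNReal.rpow_one,
      ENNReal.rpow_natCast] at h4
  have h5 : ‖a ^ k‖₊ < r ^ k := by exact_mod_cast h3
  exact_mod_cast h5.le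

variable {E : Type*} [NormedAddCommGroup E] [NormedSpace ℂ E] [FiniteDimensional ℂ E]

theorem exists_eigenvector_of_mem_spectrum {N : E →L[ℂ] E} {μ : ℂ} (hμ : μ ∈ spectrum ℂ N) :
    ∃ x, x ≠ 0 ∧ N x = μ • x := by
  have : CompleteSpace E := FiniteDimensional.complete ℂ E
  by_contra! h
  refine hμ ?_
  have hinj : Function.Injective (algebraMap ℂ (E →L[ℂ] E) μ - N) := by
    refine (injective_iff_map_eq_zero _).2 fun x hx => ?_
    by_contra hx0
    refine h x hx0 ?_
    rw [_root_.sub_apply, sub_eq_zero] at hx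
    rw [← hx]
    rfl
  exact ContinuousLinearMap.isUnit_iff_bijective.2
    ⟨hinj, LinearMap.injective_iff_surjective.1 hinj⟩

theorem exists_multiset_eigenvalues_aeval_eq_zero (N : E →ₗ[ℂ] E) :
    ∃ m : Multiset ℂ, (∀ a ∈ m, ∃ x, x ≠ 0 ∧ N x = a • x) ∧
      aeval N (m.map fun a => X - C a).prod = 0 := by
  refine ⟨N.charpoly.roots, fun a ha => ?_, ?_⟩
  · have h1 := (Module.End.hasEigenvalue_iff_isRoot_charpoly N a).2 (isRoot_of_mem_roots ha)
    obtain ⟨x, hx⟩ := h1.exists_hasEigenvector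
    exact ⟨x, hx.2, hx.apply_eq_smul⟩
  · rw [← (IsAlgClosed.splits N.charpoly).eq_prod_roots_of_monic N.charpoly_monic,
      LinearMap.aeval_self_charpoly]

end SpectralDecay

/-! ### Calculus of the splitting -/

namespace ContractionSplitting

variable {E : Type*} [NormedAddCommGroup E] [InnerProductSpace ℂ E] {A U V : E →L[ℂ] E}

theorem add_apply (h : ContractionSplitting A U V) (x : E) : U x + V x = x := by
  have := congrArg (fun L : E →L[ℂ] E => L x) h.add_eq_one
  simpa using this

theorem V_eq (h : ContractionSplitting A U V) (x : E) : V x = x - U x :=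
  eq_sub_of_add_eq' (h.add_apply x)

theorem U_V (h : ContractionSplitting A U V) (x : E) : U (V x) = 0 := by
  rw [h.V_eq, map_sub, h.comp_self, sub_self]

theorem V_U (h : ContractionSplitting A U V) (x : E) : V (U x) = 0 := by
  rw [h.V_eq, h.comp_self, sub_self]

theorem V_V (h : ContractionSplitting A U V) (x : E) : V (V x) = V x := by
  rw [h.V_eq (V x), h.U_V, sub_zero]

theorem V_A (h : ContractionSplitting A U V) (x : E) : V (A x) = A (V x) := by
  rw [h.V_eq, h.V_eq, map_sub, h.comm]

theorem norm_sq_add (h : ContractionSplitting A U V) (x y : E) :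
    ‖U x + V y‖ ^ 2 = ‖U x‖ ^ 2 + ‖V y‖ ^ 2 := by
  rw [norm_add_sq (𝕜 := ℂ), h.inner_eq_zero]
  simp

theorem norm_sq (h : ContractionSplitting A U V) (x : E) :
    ‖U x‖ ^ 2 + ‖V x‖ ^ 2 = ‖x‖ ^ 2 := by
  rw [← h.norm_sq_add, h.add_apply]

theorem norm_V_le (h : ContractionSplitting A U V) (x : E) : ‖V x‖ ≤ ‖x‖ := by
  refine (sq_le_sq₀ (norm_nonneg _) (norm_nonneg _)).1 ?_
  rw [← h.norm_sq x]
  linarith [sq_nonneg ‖U x‖]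

theorem U_pow (h : ContractionSplitting A U V) (k : ℕ) (x : E) : U ((A ^ k) x) = (A ^ k) (U x) := by
  induction k generalizing x with
  | zero => rfl
  | succ k ih =>
    change U ((A ^ k) (A x)) = (A ^ k) (A (U x))
    rw [ih, h.comm]

theorem V_pow (h : ContractionSplitting A U V) (k : ℕ) (x : E) : V ((A ^ k) x) = (A ^ k) (V x) := by
  rw [h.V_eq, h.V_eq, map_sub, h.U_pow]

theorem norm_pow_U (h : ContractionSplitting A U V) (k : ℕ) (x : E) :
    ‖(A ^ k) (U x)‖ = ‖U x‖ := by
  induction k generalizing x with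
  | zero => rfl
  | succ k ih =>
    change ‖(A ^ k) (A (U x))‖ = _
    rw [h.comm, ih, ← h.comm, h.norm_map]

/-- `V` is idempotent and commutes with `A`. Exponent `0` is excluded because it would give `1`
instead of `V`. -/
theorem mul_pow_succ (h : ContractionSplitting A U V) (k : ℕ) (x : E) :
    ((A * V) ^ (k + 1)) x = (A ^ (k + 1)) (V x) := by
  induction k generalizing x with
  | zero => simp
  | succ k ih =>
    rw [pow_succ, mul_apply_eq_comp, ih, mul_apply_eq_comp, h.V_A, h.V_V]
    rfl

/-- As `ν ≠ 0`, the vector `x` lies in the range of `V`; were `ν` unimodular, `U` would fix `x` and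
`V` would kill it. -/
theorem eigenvector_of_ne_zero (h : ContractionSplitting A U V) (hA : ∀ x, ‖A x‖ ≤ ‖x‖) {x : E}
    {ν : ℂ} (hx : x ≠ 0) (hν : ν ≠ 0) (hxν : A (V x) = ν • x) : A x = ν • x ∧ ‖ν‖ < 1 := by
  have hVx : V x = x := by
    have h1 : V (ν • x) = ν • x := by rw [← hxν, h.V_A, h.V_V]
    rw [map_smul] at h1
    exact smul_right_injective E hν h1
  rw [hVx] at hxν
  refine ⟨hxν, lt_of_le_of_ne ?_ fun h1 => hx ?_⟩
  · have h1 := hA x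
    rw [hxν, norm_smul] at h1
    exact le_of_mul_le_mul_right (by rwa [one_mul]) (norm_pos_iff.2 hx)
  · rw [← hVx, h.V_eq, h.map_eigenvector x ⟨ν, h1, hxν⟩, sub_self]

/-- `W` is diagonal on the range of `U`, with unimodular eigenvalues of `A`, and the identity on the
range of `V`. -/
theorem pow_eq_self (h : ContractionSplitting A U V) {W : E →L[ℂ] E}
    (hW : ∀ x, W x = A (U x) + V x) {N : ℕ}
    (hN : ∀ (x : E) (l : ℂ), x ≠ 0 → ‖l‖ = 1 → A x = l • x → l ^ N = 1) (x : E) : (W ^ N) x = x := by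
  have hVk : ∀ k : ℕ, (W ^ k) (V x) = V x := by
    intro k
    induction k with
    | zero => rfl
    | succ k ih =>
      change (W ^ k) (W (V x)) = _
      rw [hW, h.U_V, map_zero, zero_add, h.V_V, ih]
  have hspan : ∀ y ∈ Submodule.span ℂ (unimodularEigenvectors A), (W ^ N) y = y := by
    intro y hy
    induction hy using Submodule.span_induction with
    | mem y hy =>
      have hUy := h.map_eigenvector y hy
      obtain ⟨l, hl, hyl⟩ := hy
      have hWk : ∀ k : ℕ, (W ^ k) y = l ^ k • y := by
        intro k
        induction k with
        | zero => simp
        | succ k ih =>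
          change (W ^ k) (W y) = _
          rw [hW, h.V_eq, hUy, sub_self, add_zero, hyl, map_smul, ih, smul_smul, pow_succ']
      rcases eq_or_ne y 0 with rfl | hy0
      · simp
      · rw [hWk, hN y l hy0 hl hyl, one_smul]
    | zero => simp
    | add y z _ _ h1 h2 => rw [map_add, h1, h2]
    | smul c y _ h1 => rw [map_smul, h1]
  conv_lhs => rw [← h.add_apply x]
  rw [map_add, hspan _ (h.mem_span x), hVk, h.add_apply]

variable [FiniteDimensional ℂ E]

theorem spectrum_lt_one (h : ContractionSplitting A U V) (hA : ∀ x, ‖A x‖ ≤ ‖x‖) {μ : ℂ}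
    (hμ : μ ∈ spectrum ℂ (A * V)) : ‖μ‖ < 1 := by
  obtain ⟨x, hx, hxμ⟩ := exists_eigenvector_of_mem_spectrum hμ
  rcases eq_or_ne μ 0 with rfl | hμ0
  · simp
  · exact (h.eigenvector_of_ne_zero hA hx hμ0 hxμ).2

theorem exists_norm_pow_V_le (h : ContractionSplitting A U V) (hA : ∀ x, ‖A x‖ ≤ ‖x‖) {ε : ℝ}
    (hε : 0 < ε) : ∃ k : ℕ, 0 < k ∧ ∀ x, ‖(A ^ k) (V x)‖ ≤ ε * ‖V x‖ := by
  have : CompleteSpace E := FiniteDimensional.complete ℂ E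
  have h1 := tendsto_norm_pow_of_spectrum_lt_one (a := A * V) fun μ hμ => h.spectrum_lt_one hA hμ
  obtain ⟨k, hk, hk1⟩ := ((h1.eventually_lt_const hε).and
    (Filter.eventually_gt_atTop 0)).exists
  obtain ⟨l, rfl⟩ := Nat.exists_eq_succ_of_ne_zero hk1.ne'
  refine ⟨_, hk1, fun x => ?_⟩
  rw [← h.V_V x, ← h.mul_pow_succ, h.V_V]
  exact ((A * V) ^ (l + 1)).le_of_opNorm_le hk.le _

/-- `1 - A * V` is invertible, and the solution of `(1 - A * V) p = b` inherits `V p = p` from `b`.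
-/
theorem exists_fixed (h : ContractionSplitting A U V) (hA : ∀ x, ‖A x‖ ≤ ‖x‖) {b : E}
    (hb : V b = b) : ∃ p, V p = p ∧ A p + b = p := by
  have h1 : (1 : ℂ) ∉ spectrum ℂ (A * V) := fun h1 => by simpa using h.spectrum_lt_one hA h1
  rw [spectrum.notMem_iff, map_one] at h1
  have : CompleteSpace E := FiniteDimensional.complete ℂ E
  obtain ⟨p, hp⟩ := (ContinuousLinearMap.isUnit_iff_bijective.1 h1).2 b
  have hp' : p = A (V p) + b := by
    rw [← hp]
    simp
  have hVp : V p = p := by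
    rw [hp', map_add, hb, h.V_A, h.V_V]
  exact ⟨p, hVp, by rw [hVp] at hp'; exact hp'.symm⟩

/-- The unitary part of a contraction, extended by the identity. -/
theorem exists_linearIsometryEquiv (h : ContractionSplitting A U V) :
    ∃ W : E ≃ₗᵢ[ℂ] E, ∀ x, W x = A (U x) + V x := by
  have hnorm : ∀ x, ‖(A * U + V) x‖ = ‖x‖ := by
    intro x
    refine (sq_eq_sq₀ (norm_nonneg _) (norm_nonneg _)).1 ?_
    have h1 : (A * U + V) x = U (A x) + V x := by
      rw [← h.comm]
      rfl
    rw [h1, h.norm_sq_add, ← h.comm, h.norm_map, h.norm_sq]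
  set L : E →ₗᵢ[ℂ] E := ⟨(A * U + V : E →L[ℂ] E), hnorm⟩
  exact ⟨L.toLinearIsometryEquiv rfl, fun x => rfl⟩

/-- A nonzero range of `V`, being invariant, would contain an eigenvector; its eigenvalue is
unimodular, so `U` would fix it, contradicting `U V = 0`. -/
theorem V_eq_zero (h : ContractionSplitting A U V)
    (hA1 : ∀ (x : E) (ν : ℂ), x ≠ 0 → A x = ν • x → ‖ν‖ = 1) (x : E) : V x = 0 := by
  by_contra hx
  set S : Submodule ℂ E := LinearMap.range (V : E →ₗ[ℂ] E)
  have hS : ∀ y ∈ S, (A : E →ₗ[ℂ] E) y ∈ S := by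
    rintro _ ⟨y, rfl⟩
    exact ⟨A y, h.V_A y⟩
  have : Nontrivial S := ⟨⟨⟨V x, x, rfl⟩, 0, fun h0 => hx (congrArg Subtype.val h0)⟩⟩
  obtain ⟨ν, hν⟩ := Module.End.exists_eigenvalue ((A : E →ₗ[ℂ] E).restrict hS)
  obtain ⟨⟨_, y, rfl⟩, hy⟩ := hν.exists_hasEigenvector
  have hy0 : V y ≠ 0 := fun h0 => hy.2 (Subtype.ext h0)
  have hyν : A (V y) = ν • V y := congrArg Subtype.val hy.apply_eq_smul
  have h1 := h.map_eigenvector (V y) ⟨ν, hA1 _ ν hy0 hyν, hyν⟩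
  rw [h.U_V] at h1
  exact hy0 h1.symm

end ContractionSplitting

open scoped Pointwise

/-! ### Algebraic elements and their action on multilinear forms -/

section AlgebraicElements

/-- The element `x` is annihilated by a polynomial which is a product of linear factors with roots
in `s`. -/
def AlgebraicWithRoots {R : Type*} [Ring R] [Algebra ℂ R] (x : R) (s : Set ℂ) : Prop :=
  ∃ m : Multiset ℂ, (∀ a ∈ m, a ∈ s) ∧ aeval x (m.map fun a => X - C a).prod = 0

theorem algebraicWithRoots_one {R : Type*} [Ring R] [Algebra ℂ R] :
    AlgebraicWithRoots (1 : R) {1} := ⟨{1}, by simp, by simp⟩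

theorem AlgebraicWithRoots.mul_comm_ring {R : Type*} [CommRing R] [Algebra ℂ R] {x y : R}
    {s t : Set ℂ} (hx : AlgebraicWithRoots x s) (hy : AlgebraicWithRoots y t) :
    AlgebraicWithRoots (x * y) (s * t) := by
  obtain ⟨m, hm, hm0⟩ := hx
  obtain ⟨k, hk, hk0⟩ := hy
  -- Modulo `x - a` one has `x * y - a * b = a * (y - b)`. With `k` the roots for `y` the last term
  -- vanishes, so each `a` contributes a factor `x - a`; together these form the polynomial that
  -- kills `x`.
  have hstep : ∀ (a : ℂ) (k : Multiset ℂ), ∃ w : R,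
      aeval (x * y) (k.map fun b => X - C (a * b)).prod = (x - algebraMap ℂ R a) * w +
        algebraMap ℂ R a ^ k.card * aeval y (k.map fun b => X - C b).prod := by
    intro a k
    induction k using Multiset.induction with
    | empty => exact ⟨0, by simp⟩
    | cons b k ih =>
      obtain ⟨w, hw⟩ := ih
      refine ⟨(x * y - algebraMap ℂ R (a * b)) * w +
        y * (algebraMap ℂ R a ^ k.card * aeval y (k.map fun b => X - C b).prod), ?_⟩
      rw [Multiset.map_cons, Multiset.prod_cons, map_mul, hw, Multiset.map_cons,
        Multiset.prod_cons, map_mul, Multiset.card_cons]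
      simp only [map_sub, aeval_X, aeval_C, map_mul]
      ring
  have hall : ∀ m : Multiset ℂ, ∃ w : R,
      aeval (x * y) (m.bind fun a => k.map fun b => X - C (a * b)).prod =
        aeval x (m.map fun a => X - C a).prod * w := by
    intro m
    induction m using Multiset.induction with
    | empty => exact ⟨1, by simp⟩
    | cons a m ih =>
      obtain ⟨w, hw⟩ := ih
      obtain ⟨v, hv⟩ := hstep a k
      rw [hk0, mul_zero, add_zero] at hv
      refine ⟨v * w, ?_⟩
      rw [Multiset.cons_bind, Multiset.prod_add, map_mul, hw, hv, Multiset.map_cons,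
        Multiset.prod_cons, map_mul]
      simp only [map_sub, aeval_X, aeval_C]
      ring
  refine ⟨m.bind fun a => k.map fun b => a * b, fun c hc => ?_, ?_⟩
  · obtain ⟨a, ha, hc⟩ := Multiset.mem_bind.1 hc
    obtain ⟨b, hb, rfl⟩ := Multiset.mem_map.1 hc
    exact Set.mul_mem_mul (hm a ha) (hk b hb)
  · obtain ⟨w, hw⟩ := hall m
    rw [Multiset.map_bind]
    simp only [Multiset.map_map, Function.comp_def]
    rw [hw, hm0, zero_mul]

/-- Reduces to the commutative case inside the subalgebra generated by `x` and `y`. -/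
theorem AlgebraicWithRoots.mul {R : Type*} [Ring R] [Algebra ℂ R] {x y : R}
    {s t : Set ℂ} (hx : AlgebraicWithRoots x s) (hy : AlgebraicWithRoots y t) (hxy : Commute x y) :
    AlgebraicWithRoots (x * y) (s * t) := by
  have hcomm : ∀ a ∈ ({x, y} : Set R), ∀ b ∈ ({x, y} : Set R), a * b = b * a := by
    rintro a (rfl | rfl) b (rfl | rfl)
    exacts [rfl, hxy, hxy.symm, rfl]
  have hadj := Algebra.isMulCommutative_adjoin ℂ hcomm
  let _ : CommRing (Algebra.adjoin ℂ ({x, y} : Set R)) :=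
    { (inferInstance : Ring (Algebra.adjoin ℂ ({x, y} : Set R))) with
      mul_comm := fun a b => hadj.is_comm.comm a b }
  set x' : Algebra.adjoin ℂ ({x, y} : Set R) := ⟨x, Algebra.subset_adjoin (by simp)⟩
  set y' : Algebra.adjoin ℂ ({x, y} : Set R) := ⟨y, Algebra.subset_adjoin (by simp)⟩
  have hx' : AlgebraicWithRoots x' s := by
    obtain ⟨m, hm, hm0⟩ := hx
    refine ⟨m, hm, Subtype.ext ?_⟩
    rw [aeval_subalgebra_coe]
    exact hm0
  have hy' : AlgebraicWithRoots y' t := by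
    obtain ⟨m, hm, hm0⟩ := hy
    refine ⟨m, hm, Subtype.ext ?_⟩
    rw [aeval_subalgebra_coe]
    exact hm0
  obtain ⟨m, hm, hm0⟩ := hx'.mul_comm_ring hy'
  refine ⟨m, hm, ?_⟩
  have := congrArg Subtype.val hm0
  rwa [aeval_subalgebra_coe] at this

theorem map_aeval_of_intertwines {M P : Type*} [AddCommGroup M] [Module ℂ M] [AddCommGroup P]
    [Module ℂ P] {a : Module.End ℂ M} {b : Module.End ℂ P} (Φ : M →ₗ[ℂ] P)
    (h : ∀ x, Φ (a x) = b (Φ x)) (q : ℂ[X]) (x : M) :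
    Φ (aeval a q x) = aeval b q (Φ x) := by
  induction q using Polynomial.induction_on generalizing x with
  | C c => simp [Module.algebraMap_end_apply]
  | add q r hq hr => simp [hq, hr]
  | monomial k c ih =>
    rw [pow_succ, ← mul_assoc, map_mul (aeval a) (C c * X ^ k), map_mul (aeval b) (C c * X ^ k),
      aeval_X, aeval_X, Module.End.mul_apply, Module.End.mul_apply, ih, h]

variable {E : Type*} [AddCommGroup E] [Module ℂ E] {j : ℕ}

/-- Precomposition with a linear map in the `i`-th variable. -/
def slotMap (N : E →ₗ[ℂ] E) (i : Fin j) :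
    Module.End ℂ (MultilinearMap ℂ (fun _ : Fin j => E) ℂ) :=
  MultilinearMap.compLinearMapₗ fun l => if l = i then N else LinearMap.id

/-- Precomposition with a linear map in the first `k` variables. -/
def initialSlotMap (N : E →ₗ[ℂ] E) (k : ℕ) :
    Module.End ℂ (MultilinearMap ℂ (fun _ : Fin j => E) ℂ) :=
  MultilinearMap.compLinearMapₗ fun l => if l.val < k then N else LinearMap.id

theorem slotMap_apply (N : E →ₗ[ℂ] E) (i : Fin j) (M : MultilinearMap ℂ (fun _ : Fin j => E) ℂ)
    (v : Fin j → E) : slotMap N i M v = M (Function.update v i (N (v i))) := by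
  simp only [slotMap, MultilinearMap.compLinearMapₗ_apply, MultilinearMap.compLinearMap_apply]
  congr 1
  ext l
  by_cases hl : l = i
  · subst hl
    simp
  · simp [hl]

theorem initialSlotMap_apply (N : E →ₗ[ℂ] E) (k : ℕ) (M : MultilinearMap ℂ (fun _ : Fin j => E) ℂ)
    (v : Fin j → E) :
    initialSlotMap N k M v = M fun l => if l.val < k then N (v l) else v l := by
  simp only [initialSlotMap, MultilinearMap.compLinearMapₗ_apply,
    MultilinearMap.compLinearMap_apply]
  congr 1
  ext l
  split_ifs <;> rfl

theorem aeval_slotMap (N : E →ₗ[ℂ] E) (i : Fin j) (q : ℂ[X])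
    (M : MultilinearMap ℂ (fun _ : Fin j => E) ℂ) (v : Fin j → E) :
    aeval (slotMap N i) q M v = M (Function.update v i (aeval N q (v i))) := by
  induction q using Polynomial.induction_on generalizing M with
  | C c => simp [Module.algebraMap_end_apply]
  | add q r hq hr => simp [hq, hr]
  | monomial k c ih =>
    have h1 : (C c * X ^ (k + 1) : ℂ[X]) = X * (C c * X ^ k) := by ring
    have h2 : (C c * X ^ (k + 1) : ℂ[X]) = C c * X ^ k * X := by ring
    have h3 : aeval N (C c * X ^ (k + 1)) (v i) = N (aeval N (C c * X ^ k) (v i)) := by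
      rw [h1, map_mul, aeval_X]
      rfl
    have h4 : aeval (slotMap N i) (C c * X ^ (k + 1)) M =
        aeval (slotMap N i) (C c * X ^ k) (slotMap N i M) := by
      rw [h2, map_mul, aeval_X]
      rfl
    rw [h3, h4, ih, slotMap_apply, Function.update_idem, Function.update_self]

theorem algebraicWithRoots_slotMap {N : E →ₗ[ℂ] E} {s : Set ℂ} (hN : AlgebraicWithRoots N s)
    (i : Fin j) : AlgebraicWithRoots (slotMap N i) s := by
  obtain ⟨m, hm, hm0⟩ := hN
  refine ⟨m, hm, ?_⟩
  ext M v
  rw [aeval_slotMap, hm0]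
  simp

theorem commute_initialSlotMap_slotMap (N : E →ₗ[ℂ] E) {k : ℕ} (hk : k < j) :
    Commute (initialSlotMap N k) (slotMap N (⟨k, hk⟩ : Fin j)) := by
  ext M v
  change initialSlotMap N k (slotMap N _ M) v = slotMap N _ (initialSlotMap N k M) v
  rw [initialSlotMap_apply, slotMap_apply, slotMap_apply, initialSlotMap_apply]
  congr 1
  ext l
  by_cases hl : l = ⟨k, hk⟩
  · subst hl
    simp
  · simp [hl]

theorem initialSlotMap_succ (N : E →ₗ[ℂ] E) {k : ℕ} (hk : k < j) :
    initialSlotMap N (k + 1) = initialSlotMap N k * slotMap N (⟨k, hk⟩ : Fin j) := by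
  ext M v
  change _ = initialSlotMap N k (slotMap N _ M) v
  rw [initialSlotMap_apply, initialSlotMap_apply, slotMap_apply]
  congr 1
  ext l
  by_cases hl : l = ⟨k, hk⟩
  · subst hl
    simp
  · have hl' : l.val ≠ k := fun h => hl (Fin.ext h)
    simp only [Function.update_of_ne hl]
    have : l.val < k + 1 ↔ l.val < k := by omega
    simp [this]

/-- Precompositions in different variables commute, so the roots multiply one variable at a time.
For `k = j` the operator acts on the diagonal as composition with `N`, which is how products of `j`
eigenvalues arise. -/
theorem algebraicWithRoots_initialSlotMap {N : E →ₗ[ℂ] E} {s : Set ℂ}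
    (hN : AlgebraicWithRoots N s) {k : ℕ} (hk : k ≤ j) :
    AlgebraicWithRoots (initialSlotMap N k : Module.End ℂ
      (MultilinearMap ℂ (fun _ : Fin j => E) ℂ)) (s ^ k) := by
  induction k with
  | zero =>
    have : (initialSlotMap N 0 : Module.End ℂ (MultilinearMap ℂ (fun _ : Fin j => E) ℂ)) = 1 := by
      ext M v
      simp [initialSlotMap_apply]
    rw [this, pow_zero]
    exact algebraicWithRoots_one
  | succ k ih =>
    rw [initialSlotMap_succ N hk, pow_succ]
    exact (ih (Nat.le_of_succ_le hk)).mul (algebraicWithRoots_slotMap hN _)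
      (commute_initialSlotMap_slotMap N hk)

end AlgebraicElements

/-! ### Inverses relative to a commuting element -/

section RelativeInverse

/-- Induction on the roots. With `u = a r - μ` one has `u = (r s - μ) - r (s - a)`; if `y` solves
the problem for `(s - a) P`, then `u⁻¹ (P - r y)` solves it for `P`. -/
theorem exists_relative_inverse {R : Type*} [Ring R] [Algebra ℂ R] {r s : R} (hrs : Commute r s)
    (μ : ℂ) (m : Multiset ℂ)
    (hm : ∀ a ∈ m, IsUnit (algebraMap ℂ R a * r - algebraMap ℂ R μ)) {P : R} (hPr : Commute P r)
    (hPs : Commute P s) (hP : aeval s (m.map fun a => X - C a).prod * P = 0) :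
    ∃ y, Commute y r ∧ Commute y s ∧ (r * s - algebraMap ℂ R μ) * y = P := by
  induction m using Multiset.induction generalizing P with
  | empty =>
    refine ⟨0, Commute.zero_left _, Commute.zero_left _, ?_⟩
    simpa using hP.symm
  | cons a m ih =>
    have hcs : Commute (algebraMap ℂ R a) s := Algebra.commutes a s
    have hcr : Commute (algebraMap ℂ R a) r := Algebra.commutes a r
    obtain ⟨y, hyr, hys, hy⟩ := ih (fun b hb => hm b (Multiset.mem_cons_of_mem hb))
      (P := (s - algebraMap ℂ R a) * P) ((hrs.symm.sub_left hcr).mul_left hPr)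
      (((Commute.refl s).sub_left hcs).mul_left hPs) (by
        rw [Multiset.map_cons, Multiset.prod_cons, mul_comm, map_mul, mul_assoc] at hP
        simpa using hP)
    obtain ⟨u, hu⟩ := hm a (Multiset.mem_cons_self a m)
    have hur : Commute (u : R) r := by
      rw [hu]
      exact (hcr.mul_left (Commute.refl r)).sub_left (Algebra.commutes μ r)
    have hus : Commute (u : R) s := by
      rw [hu]
      exact (hcs.mul_left hrs).sub_left (Algebra.commutes μ s)
    have hvr : Commute ((u⁻¹ : Rˣ) : R) r := hur.units_inv_left
    have hvs : Commute ((u⁻¹ : Rˣ) : R) s := hus.units_inv_left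
    have hvx : Commute ((u⁻¹ : Rˣ) : R) (r * s - algebraMap ℂ R μ) :=
      (hvr.mul_right hvs).sub_right (Algebra.commutes μ _).symm
    have hrx : Commute r (r * s - algebraMap ℂ R μ) :=
      ((Commute.refl r).mul_right hrs).sub_right (Algebra.commutes μ _).symm
    refine ⟨(u⁻¹ : Rˣ) * (P - r * y), hvr.mul_left (hPr.sub_left ((Commute.refl r).mul_left hyr)),
      hvs.mul_left (hPs.sub_left (hrs.mul_left hys)), ?_⟩
    have h1 : r * s - algebraMap ℂ R μ - r * (s - algebraMap ℂ R a) = u := by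
      rw [hu, mul_sub, ← Algebra.commutes a r]
      abel
    rw [← mul_assoc, ← hvx.eq, mul_assoc, mul_sub, ← mul_assoc _ r y, ← hrx.eq, mul_assoc r, hy,
      ← mul_assoc r, ← sub_mul, h1, ← mul_assoc, Units.inv_mul, one_mul]

/-- The geometric sum `s` satisfies `(x - μ) s = x ^ k - μ ^ k`, and on `Q` the right side is minus
the unit `μ ^ k - x ^ k Q` given by the Neumann series. -/
theorem exists_relative_inverse_of_pow {R : Type*} [NormedRing R] [NormedAlgebra ℂ R]
    [CompleteSpace R] {x Q : R} (hQx : Commute Q x) (hQ : Q * Q = Q) {μ : ℂ} {k : ℕ}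
    (h : ‖x ^ k * Q‖ * ‖(1 : R)‖ < ‖μ‖ ^ k) :
    ∃ y, Commute y x ∧ (x - algebraMap ℂ R μ) * y = Q := by
  have hX : IsUnit (algebraMap ℂ R (μ ^ k) - x ^ k * Q) := by
    refine spectrum.mem_resolventSet_iff.1 (spectrum.mem_resolventSet_of_norm_lt_mul ?_)
    rwa [norm_pow]
  obtain ⟨u, hu⟩ := hX
  have hxk : Commute (x ^ k) x := (Commute.refl x).pow_left k
  have hux : Commute (u : R) x := by
    rw [hu]
    exact (Algebra.commute_algebraMap_left _ x).sub_left (hxk.mul_left hQx)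
  have hvx : Commute ((u⁻¹ : Rˣ) : R) x := hux.units_inv_left
  have hμx : Commute x (algebraMap ℂ R μ) := (Algebra.commutes μ x).symm
  set s := ∑ i ∈ Finset.range k, x ^ i * algebraMap ℂ R μ ^ (k - 1 - i)
  have hs : Commute s x := Commute.sum_left _ _ _ fun i _ =>
    ((Commute.refl x).pow_left i).mul_left ((Algebra.commute_algebraMap_left μ x).pow_left _)
  have hgeom : (x - algebraMap ℂ R μ) * s = x ^ k - algebraMap ℂ R μ ^ k := hμx.mul_geom_sum₂ k
  refine ⟨-(s * Q * (u⁻¹ : Rˣ)), ((hs.mul_left hQx).mul_left hvx).neg_left, ?_⟩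
  have h1 : (x ^ k - algebraMap ℂ R μ ^ k) * Q = -(Q * u) := by
    rw [hu, mul_sub, ← map_pow, ← (Algebra.commutes (μ ^ k) Q), sub_mul,
      ← mul_assoc, (hQx.pow_right k).eq, mul_assoc (x ^ k), hQ]
    abel
  rw [mul_neg, ← mul_assoc, ← mul_assoc, hgeom, h1, neg_mul, neg_neg, mul_assoc, Units.mul_inv,
    mul_one]

end RelativeInverse

/-! ### Composition with a unitary map -/

section CompositionByIsometry

variable {n : ℕ}

theorem lintegral_comp_isometry (W : CSpace n ≃ₗᵢ[ℂ] CSpace n) {f : CSpace n → ℂ}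
    (hf : Differentiable ℂ f) : ∫⁻ z, ‖f (W z)‖ₑ ^ 2 ∂(fockMeasure n) =
      ∫⁻ z, ‖f z‖ₑ ^ 2 ∂(fockMeasure n) := by
  set W' : CSpace n ≃ₗᵢ[ℝ] CSpace n := ⟨W.toLinearEquiv.restrictScalars ℝ, W.norm_map⟩
  have hW : Differentiable ℂ W := W.toContinuousLinearEquiv.differentiable
  rw [lintegral_fockMeasure (measurable_enorm_sq (f := fun z => f (W z)) (hf.comp hW)),
    lintegral_fockMeasure (measurable_enorm_sq hf), ← (LinearIsometryEquiv.measurePreserving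
      W').lintegral_comp (f := fun z => ENNReal.ofReal (gaussWeight n z) * ‖f z‖ₑ ^ 2)
        (measurable_ofReal_gaussWeight.mul (measurable_enorm_sq hf))]
  refine lintegral_congr fun z => ?_
  change _ = ENNReal.ofReal (gaussWeight n (W z)) * ‖f (W z)‖ₑ ^ 2
  rw [gaussWeight, gaussWeight, W.norm_map]

theorem boundedComposition_isometry (W : CSpace n ≃ₗᵢ[ℂ] CSpace n) :
    BoundedComposition (W : CSpace n → CSpace n) := by
  have hW : Differentiable ℂ W := W.toContinuousLinearEquiv.differentiable
  refine ⟨fun f => mem_fockSubmodule_iff.2 ⟨f.differentiable.comp hW, ?_⟩, 1, fun f => ?_⟩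
  · rw [lintegral_comp_isometry W f.differentiable]
    exact (mem_fockSubmodule_iff.1 f.mem).2
  · refine Fock.norm_le_of_enorm_sq_le zero_le_one ?_
    rw [one_pow, ENNReal.ofReal_one, one_mul]
    exact (lintegral_comp_isometry W f.differentiable).le

/-- Composition with a linear isometry. -/
noncomputable def isometryOperator (W : CSpace n ≃ₗᵢ[ℂ] CSpace n) : Fock n →L[ℂ] Fock n :=
  compositionOperator W (boundedComposition_isometry W)

theorem norm_isometryOperator_le (W : CSpace n ≃ₗᵢ[ℂ] CSpace n) : ‖isometryOperator W‖ ≤ 1 := by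
  refine ContinuousLinearMap.opNorm_le_bound _ zero_le_one fun f => ?_
  refine Fock.norm_le_of_enorm_sq_le zero_le_one ?_
  rw [one_pow, ENNReal.ofReal_one, one_mul]
  exact (lintegral_comp_isometry W f.differentiable).le

theorem isometryOperator_mul_symm (W : CSpace n ≃ₗᵢ[ℂ] CSpace n) :
    isometryOperator W * isometryOperator W.symm = 1 := by
  refine ContinuousLinearMap.ext fun f => DFunLike.ext _ _ fun z => ?_
  change f (W.symm (W z)) = f z
  rw [W.symm_apply_apply]

/-- Composition with a linear isometry, as an invertible operator. -/
noncomputable def isometryUnit (W : CSpace n ≃ₗᵢ[ℂ] CSpace n) : (Fock n →L[ℂ] Fock n)ˣ where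
  val := isometryOperator W
  inv := isometryOperator W.symm
  val_inv := isometryOperator_mul_symm W
  inv_val := isometryOperator_mul_symm W.symm

/-- The operator and its inverse both have norm at most `1`. -/
theorem norm_eq_one_of_mem_spectrum_isometryOperator {W : CSpace n ≃ₗᵢ[ℂ] CSpace n} {μ : ℂ}
    (hμ : μ ∈ spectrum ℂ (isometryOperator W)) : ‖μ‖ = 1 := by
  have h1 : ‖(1 : Fock n →L[ℂ] Fock n)‖ ≤ 1 := ContinuousLinearMap.norm_id_le
  have hle : ∀ (W : CSpace n ≃ₗᵢ[ℂ] CSpace n) (ν : ℂ), ν ∈ spectrum ℂ (isometryOperator W) →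
      ‖ν‖ ≤ 1 := fun W ν hν =>
    (spectrum.norm_le_norm_mul_of_mem hν).trans
      (mul_le_one₀ (norm_isometryOperator_le W) (norm_nonneg _) h1)
  refine le_antisymm (hle W μ hμ) ?_
  have hμ0 : μ ≠ 0 := by
    rintro rfl
    exact spectrum.zero_notMem (R := ℂ) (isometryUnit W).isUnit hμ
  have h2 : (Units.mk0 μ hμ0 : ℂ) ∈ spectrum ℂ (isometryUnit W : Fock n →L[ℂ] Fock n) := hμ
  have h3 := hle W.symm _ ((spectrum.inv_mem_iff (a := isometryUnit W)).1 h2)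
  rw [Units.val_inv_eq_inv_val, Units.val_mk0, norm_inv] at h3
  exact (inv_le_one_iff₀.1 h3).resolve_left (not_le.2 (norm_pos_iff.2 hμ0))

theorem isometryOperator_pow_apply (W : CSpace n ≃ₗᵢ[ℂ] CSpace n) (k : ℕ) (f : Fock n)
    (z : CSpace n) : (isometryOperator W ^ k) f z = f (W^[k] z) := by
  induction k generalizing f with
  | zero => rfl
  | succ k ih =>
    rw [pow_succ, Function.iterate_succ_apply']
    exact ih (isometryOperator W f)

theorem pow_eq_one_of_mem_spectrum_isometryOperator {W : CSpace n ≃ₗᵢ[ℂ] CSpace n} {N : ℕ}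
    (hN : ∀ z, W^[N] z = z) {μ : ℂ} (hμ : μ ∈ spectrum ℂ (isometryOperator W)) : μ ^ N = 1 := by
  have h1 : isometryOperator W ^ N = 1 := by
    refine ContinuousLinearMap.ext fun f => DFunLike.ext _ _ fun z => ?_
    rw [isometryOperator_pow_apply, hN]
    rfl
  have h2 := spectrum.pow_mem_pow (isometryOperator W) N hμ
  have : Nontrivial (Fock n) := ⟨⟨Fock.one n, 0, norm_pos_iff.1 Fock.norm_one_pos⟩⟩
  rw [h1, spectrum.one_eq] at h2
  exact h2

end CompositionByIsometry

/-! ### Homogeneous expansion along the range of `V` -/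

section TransverseExpansion

variable {n : ℕ} {A U V : CSpace n →L[ℂ] CSpace n} {p : CSpace n}

/-- The dilation by `t` around `p` along the range of `V`. -/
noncomputable def transverseDilation (U V : CSpace n →L[ℂ] CSpace n) (p : CSpace n) (t : ℂ) (z : CSpace n) :
    CSpace n := U z + p + t • (V z - p)

/-- The coefficient of degree `j` of `f` along the range of `V`, around `p`. -/
noncomputable def transverseCoeff (U V : CSpace n →L[ℂ] CSpace n) (p : CSpace n)
    (f : CSpace n → ℂ) (j : ℕ) (z : CSpace n) : ℂ :=
  taylorCoeff (fun t => f (transverseDilation U V p t z)) j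

theorem differentiable_comp_transverseDilation {f : CSpace n → ℂ} (hf : Differentiable ℂ f)
    (z : CSpace n) : Differentiable ℂ fun t => f (transverseDilation U V p t z) :=
  differentiable_comp_line hf _ _

theorem ContractionSplitting.U_fixed (h : ContractionSplitting A U V) (hp : V p = p) :
    U p = 0 := by
  rw [← hp, h.U_V]

theorem ContractionSplitting.U_transverseDilation (h : ContractionSplitting A U V) (hp : V p = p)
    (t : ℂ) (z : CSpace n) : U (transverseDilation U V p t z) = U z := by
  rw [transverseDilation, map_add, map_add, map_smul, map_sub, h.comp_self, h.U_fixed hp, h.U_V]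
  simp

theorem ContractionSplitting.V_transverseDilation (h : ContractionSplitting A U V) (hp : V p = p)
    (t : ℂ) (z : CSpace n) :
    V (transverseDilation U V p t z) = p + t • (V z - p) := by
  rw [transverseDilation, map_add, map_add, map_smul, map_sub, h.V_U, hp, h.V_V, zero_add]

theorem ContractionSplitting.transverseDilation_comp (h : ContractionSplitting A U V)
    (hp : V p = p) (s t : ℂ) (z : CSpace n) :
    transverseDilation U V p s (transverseDilation U V p t z) =
      transverseDilation U V p (t * s) z := by
  rw [transverseDilation, h.U_transverseDilation hp, h.V_transverseDilation hp,
    transverseDilation, add_sub_cancel_left, smul_smul, mul_comm s t]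

/-- This form shows holomorphy in `z` and exhibits the coefficient as a `j`-linear form on the
diagonal. -/
theorem transverseCoeff_eq {f : CSpace n → ℂ} (hf : Differentiable ℂ f) (j : ℕ) (z : CSpace n) :
    transverseCoeff U V p f j z =
      (j.factorial : ℂ)⁻¹ * iteratedFDeriv ℂ j f (U z + p) fun _ => V z - p := by
  rw [← iteratedDeriv_comp_line hf]
  rfl

theorem differentiable_transverseCoeff {f : CSpace n → ℂ} (hf : Differentiable ℂ f) (j : ℕ) :
    Differentiable ℂ (transverseCoeff U V p f j) := by
  have h1 : transverseCoeff U V p f j = fun z =>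
      (j.factorial : ℂ)⁻¹ * iteratedFDeriv ℂ j f (U z + p) fun _ => V z - p :=
    funext fun z => transverseCoeff_eq hf j z
  have h2 : Differentiable ℂ (iteratedFDeriv ℂ j f) :=
    (contDiff_nat_of_differentiable hf (j + 1)).differentiable_iteratedFDeriv
      (by exact_mod_cast Nat.lt_succ_self j)
  have h3 : Differentiable ℂ fun z => iteratedFDeriv ℂ j f (U z + p) :=
    h2.comp (U.differentiable.add_const p)
  have h4 : Differentiable ℂ fun z => V z - p := V.differentiable.sub_const p
  rw [h1]
  refine Differentiable.const_mul (fun z => ?_) _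
  exact ((h3 z).hasFDerivAt.continuousMultilinearMap_apply
    fun _ => (h4 z).hasFDerivAt).differentiableAt

theorem ContractionSplitting.transverseCoeff_transverseDilation (h : ContractionSplitting A U V)
    (hp : V p = p) {f : CSpace n → ℂ} (hf : Differentiable ℂ f) (j : ℕ) (t : ℂ) (z : CSpace n) :
    transverseCoeff U V p f j (transverseDilation U V p t z) =
      t ^ j * transverseCoeff U V p f j z := by
  rw [transverseCoeff, transverseCoeff,
    ← taylorCoeff_comp_mul_left (differentiable_comp_transverseDilation hf z)]
  congr 1
  ext s
  rw [h.transverseDilation_comp hp]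

theorem ContractionSplitting.transverseCoeff_transverseCoeff (h : ContractionSplitting A U V)
    (hp : V p = p) {f : CSpace n → ℂ} (hf : Differentiable ℂ f) (i j : ℕ) (z : CSpace n) :
    transverseCoeff U V p (transverseCoeff U V p f j) i z =
      if i = j then transverseCoeff U V p f j z else 0 := by
  rw [transverseCoeff]
  simp_rw [h.transverseCoeff_transverseDilation hp hf]
  exact taylorCoeff_pow_mul_const j i _

theorem taylorCoeff_add {f g : ℂ → ℂ} (hf : Differentiable ℂ f) (hg : Differentiable ℂ g) (j : ℕ) :
    taylorCoeff (fun t => f t + g t) j = taylorCoeff f j + taylorCoeff g j := by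
  refine taylorCoeff_eq_of_forall_hasSum (a := fun j => taylorCoeff f j + taylorCoeff g j)
    (fun t => ?_) j
  refine ((hasSum_taylorCoeff hf t).add (hasSum_taylorCoeff hg t)).congr_fun fun i => ?_
  ring

theorem taylorCoeff_const_mul {f : ℂ → ℂ} (hf : Differentiable ℂ f) (c : ℂ) (j : ℕ) :
    taylorCoeff (fun t => c * f t) j = c * taylorCoeff f j := by
  refine taylorCoeff_eq_of_forall_hasSum (a := fun j => c * taylorCoeff f j) (fun t => ?_) j
  refine ((hasSum_taylorCoeff hf t).mul_left c).congr_fun fun i => ?_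
  ring

/-- The map `c • A ^ k` may be singular on the range of `V`; adding a multiple of modulus `1 / 2` of
the identity makes it injective there, since `1 / 4 < 1 / 2`, and keeps its norm at most `3 / 4`. -/
theorem ContractionSplitting.exists_norm_le_of_circle_average (h : ContractionSplitting A U V)
    (hp : V p = p) (k : ℕ) (c : ℂ) (hc : ∀ x, ‖c • (A ^ k) (V x)‖ ≤ 1 / 4 * ‖V x‖) :
    ∃ K : ℝ, 0 ≤ K ∧ ∀ (f : Fock n) (g : CSpace n → ℂ) (C : ℝ), Differentiable ℂ g → 0 ≤ C →
      (∀ z, ‖g z‖ ≤ C * ((2 * Real.pi)⁻¹ * ∫ θ in (0 : ℝ)..2 * Real.pi,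
        ‖f ((A ^ k) (U z) + p + c • (A ^ k) (V z - p) +
          circleMap 0 (1 / 2) θ • (V z - p))‖)) →
      ∃ h : g ∈ fockSubmodule n, ‖Fock.mk g h‖ ≤ C * K * ‖f‖ := by
  set s : ℝ → ℂ := circleMap 0 (1 / 2)
  have hs : ∀ θ, ‖s θ‖ = 1 / 2 := fun θ => by simp [s]
  have hsc : Continuous s := continuous_circleMap 0 (1 / 2)
  set B : CSpace n →L[ℂ] CSpace n := A ^ k * U + c • (A ^ k * V)
  have hsplit : ∀ θ z, (p - c • (A ^ k) p - s θ • p) + (B + s θ • V) z =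
      (A ^ k) (U z) + p + c • (A ^ k) (V z - p) + s θ • (V z - p) := by
    intro θ z
    have : (B + s θ • V) z = (A ^ k) (U z) + c • (A ^ k) (V z) + s θ • V z := rfl
    rw [this, map_sub, smul_sub, smul_sub]
    abel
  have hVp : ∀ z, V z - p = V (z - p) := fun z => by rw [map_sub, hp]
  have hle : ∀ θ x, ‖c • (A ^ k) (V x) + s θ • V x‖ ≤ 3 / 4 * ‖V x‖ := by
    intro θ x
    have h1 := norm_add_le (c • (A ^ k) (V x)) (s θ • V x)
    rw [norm_smul (s θ), hs] at h1
    linarith [hc x]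
  have hsum : ∀ θ z, (p - c • (A ^ k) p - s θ • p) + (B + s θ • V) z =
      U ((A ^ k) z) + V (p + (c • (A ^ k) (V z - p) + s θ • (V z - p))) := by
    intro θ z
    rw [hsplit, hVp, map_add, map_add, map_smul, map_smul, h.V_pow, h.V_V, hp, h.U_pow]
    abel
  have hinj : ∀ θ, Function.Injective (B + s θ • V) := by
    intro θ
    refine (injective_iff_map_eq_zero (B + s θ • V)).2 fun z hz => ?_
    have h1 : (B + s θ • V) z = U ((A ^ k) z) + V (c • (A ^ k) (V z) + s θ • V z) := by
      have : (B + s θ • V) z = (A ^ k) (U z) + c • (A ^ k) (V z) + s θ • V z := rfl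
      rw [this, map_add, map_smul, map_smul, h.V_pow, h.V_V, h.U_pow]
      abel
    have h2 := h.norm_sq_add ((A ^ k) z) (c • (A ^ k) (V z) + s θ • V z)
    rw [← h1, hz, norm_zero, h.U_pow, h.norm_pow_U] at h2
    have h3 : ‖U z‖ = 0 := by nlinarith [sq_nonneg ‖V (c • (A ^ k) (V z) + s θ • V z)‖]
    have h4 : ‖V (c • (A ^ k) (V z) + s θ • V z)‖ = 0 := by
      nlinarith [sq_nonneg ‖V (c • (A ^ k) (V z) + s θ • V z)‖]
    rw [map_add, map_smul, map_smul, h.V_pow, h.V_V] at h4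
    have h5 : ‖s θ • V z‖ ≤ ‖c • (A ^ k) (V z) + s θ • V z‖ + ‖c • (A ^ k) (V z)‖ := by
      have := norm_sub_le (c • (A ^ k) (V z) + s θ • V z) (c • (A ^ k) (V z))
      rwa [add_sub_cancel_left] at this
    rw [h4, norm_smul, hs] at h5
    have h6 : ‖V z‖ = 0 := le_antisymm (by linarith [hc z]) (norm_nonneg _)
    rw [← h.add_apply z, norm_eq_zero.1 h3, norm_eq_zero.1 h6, add_zero]
  have hbound : ∀ θ z, ‖(p - c • (A ^ k) p - s θ • p) + (B + s θ • V) z‖ ^ 2 ≤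
      ‖z‖ ^ 2 + 7 * ‖p‖ ^ 2 := by
    intro θ z
    rw [hsum, h.norm_sq_add, h.U_pow, h.norm_pow_U, ← h.norm_sq z, hVp, add_assoc]
    gcongr
    have h1 : ‖V (p + (c • (A ^ k) (V (z - p)) + s θ • V (z - p)))‖ ≤
        ‖p‖ + 3 / 4 * (‖V z‖ + ‖p‖) := by
      refine (h.norm_V_le _).trans ((norm_add_le _ _).trans ?_)
      gcongr
      refine (hle θ (z - p)).trans ?_
      rw [← hVp]
      gcongr
      exact norm_sub_le _ _
    refine (pow_le_pow_left₀ (norm_nonneg _) h1 2).trans ?_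
    -- The factor `3 / 4 < 1` leaves room for the shift by `p`: with `7`, the difference of the two
    -- sides is exactly `7 / 16 * (‖V z‖ - 3 * ‖p‖)²`.
    nlinarith [sq_nonneg (‖V z‖ - 3 * ‖p‖)]
  obtain ⟨K, hK, hmain⟩ := _root_.exists_norm_le_of_circle_average
    (fun θ => p - c • (A ^ k) p - s θ • p) (fun θ => B + s θ • V)
    (continuous_const.sub (hsc.smul continuous_const))
    (continuous_const.add (hsc.smul continuous_const)) hinj hbound
  refine ⟨K, hK, fun f g C hg hC hle => hmain f g C hg hC fun z => ?_⟩
  simp_rw [hsplit]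
  exact hle z

theorem ContractionSplitting.exists_transverse_bound (h : ContractionSplitting A U V)
    (hp : V p = p) :
    ∃ K : ℝ, 0 ≤ K ∧ ∀ (f : Fock n) (g : CSpace n → ℂ) (C : ℝ), Differentiable ℂ g → 0 ≤ C →
      (∀ z, ‖g z‖ ≤ C * ((2 * Real.pi)⁻¹ * ∫ θ in (0 : ℝ)..2 * Real.pi,
        ‖f (transverseDilation U V p (circleMap 0 (1 / 2) θ) z)‖)) →
      ∃ h : g ∈ fockSubmodule n, ‖Fock.mk g h‖ ≤ C * K * ‖f‖ := by
  obtain ⟨K, hK, hmain⟩ := h.exists_norm_le_of_circle_average hp 0 0 (fun x => by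
    rw [zero_smul, norm_zero]
    positivity)
  refine ⟨K, hK, fun f g C hg hC hle => hmain f g C hg hC fun z => ?_⟩
  simpa [transverseDilation] using hle z

theorem ContractionSplitting.exists_transverseCoeff_bound (h : ContractionSplitting A U V)
    (hp : V p = p) (j : ℕ) : ∃ K : ℝ, ∀ f : Fock n,
      ∃ h : transverseCoeff U V p f j ∈ fockSubmodule n, ‖Fock.mk _ h‖ ≤ K * ‖f‖ := by
  obtain ⟨K, hK, hmain⟩ := h.exists_transverse_bound hp
  refine ⟨2 ^ j * K, fun f => hmain f _ _ (differentiable_transverseCoeff f.differentiable j)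
    (by positivity) fun z => ?_⟩
  have h1 := norm_taylorCoeff_mul_pow_le (r := 1 / 2)
    (differentiable_comp_transverseDilation (U := U) (V := V) (p := p) f.differentiable z)
    (by norm_num) j
  rw [one_div, inv_pow, mul_inv_le_iff₀ (by positivity)] at h1
  rw [mul_comm, one_div]
  exact h1

/-- The projection of the Fock space on the functions which are homogeneous of degree `j` along the
range of `V`, around `p`. -/
noncomputable def transverseProjection (h : ContractionSplitting A U V) (hp : V p = p) (j : ℕ) :
    Fock n →L[ℂ] Fock n :=
  LinearMap.mkContinuousOfExistsBound
    { toFun := fun f => Fock.mk (transverseCoeff U V p f j)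
        ((h.exists_transverseCoeff_bound hp j).choose_spec f).choose
      map_add' := fun f g => DFunLike.ext _ _ fun z =>
        taylorCoeff_add (differentiable_comp_transverseDilation f.differentiable z)
          (differentiable_comp_transverseDilation g.differentiable z) j
      map_smul' := fun c f => DFunLike.ext _ _ fun z =>
        taylorCoeff_const_mul (differentiable_comp_transverseDilation f.differentiable z) c j }
    ⟨_, fun f => ((h.exists_transverseCoeff_bound hp j).choose_spec f).choose_spec⟩

theorem transverseProjection_apply (h : ContractionSplitting A U V) (hp : V p = p) (j : ℕ)
    (f : Fock n) (z : CSpace n) :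
    transverseProjection h hp j f z = transverseCoeff U V p f j z := rfl

theorem transverseProjection_mul (h : ContractionSplitting A U V) (hp : V p = p) (i j : ℕ) :
    transverseProjection h hp i * transverseProjection h hp j =
      if i = j then transverseProjection h hp j else 0 := by
  refine ContinuousLinearMap.ext fun f => DFunLike.ext _ _ fun z => ?_
  refine (h.transverseCoeff_transverseCoeff hp f.differentiable i j z).trans ?_
  split_ifs <;> rfl

/-- Composition with a map commuting with all dilations preserves the degree of homogeneity. -/
theorem commute_transverseProjection (h : ContractionSplitting A U V) (hp : V p = p) (j : ℕ)
    {ψ : CSpace n → CSpace n} {T : Fock n →L[ℂ] Fock n} (hT : ∀ f z, T f z = f (ψ z))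
    (hψ : ∀ t z, ψ (transverseDilation U V p t z) = transverseDilation U V p t (ψ z)) :
    Commute (transverseProjection h hp j) T := by
  refine ContinuousLinearMap.ext fun f => DFunLike.ext _ _ fun z => ?_
  change transverseCoeff U V p (T f) j z = T (transverseProjection h hp j f) z
  rw [hT, transverseProjection_apply, transverseCoeff, transverseCoeff]
  congr 1
  ext t
  rw [hT, hψ]

/-- The complement of the first `m` transverse projections. -/
noncomputable def transverseRemainder (h : ContractionSplitting A U V) (hp : V p = p) (m : ℕ) :
    Fock n →L[ℂ] Fock n := 1 - ∑ j ∈ Finset.range m, transverseProjection h hp j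

theorem transverseRemainder_mul_self (h : ContractionSplitting A U V) (hp : V p = p) (m : ℕ) :
    transverseRemainder h hp m * transverseRemainder h hp m = transverseRemainder h hp m := by
  have h1 : (∑ j ∈ Finset.range m, transverseProjection h hp j) *
      (∑ j ∈ Finset.range m, transverseProjection h hp j) =
      ∑ j ∈ Finset.range m, transverseProjection h hp j := by
    rw [Finset.sum_mul_sum]
    refine Finset.sum_congr rfl fun i hi => ?_
    simp_rw [transverseProjection_mul]
    rw [Finset.sum_ite_eq, if_pos hi]
  rw [transverseRemainder, mul_sub, sub_mul, sub_mul, h1]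
  simp

theorem transverseRemainder_apply (h : ContractionSplitting A U V) (hp : V p = p) (m : ℕ)
    (f : Fock n) (z : CSpace n) : transverseRemainder h hp m f z =
      f z - ∑ j ∈ Finset.range m, transverseCoeff U V p f j z := by
  have h1 : transverseRemainder h hp m f =
      f - ∑ j ∈ Finset.range m, transverseProjection h hp j f := by
    rw [transverseRemainder, _root_.sub_apply, _root_.sum_apply]
    rfl
  rw [h1, Fock.sub_apply, Fock.sum_apply]
  rfl

/-- The dilation by `1 / 4` is half of the averaging radius `1 / 2`, so the Taylor tail gains `2⁻¹ ^
m`. -/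
theorem exists_transverseRemainder_bound (h : ContractionSplitting A U V) (hp : V p = p) :
    ∃ K : ℝ, 0 ≤ K ∧ ∀ (m : ℕ) (f : Fock n), ∃ g : Fock n, ‖g‖ ≤ 2⁻¹ ^ m * K * ‖f‖ ∧
      ∀ z, g z = transverseRemainder h hp m f (transverseDilation U V p (1 / 4) z) := by
  obtain ⟨K, hK, hmain⟩ := h.exists_transverse_bound hp
  refine ⟨2 * K, by positivity, fun m f => ?_⟩
  have hd : Differentiable ℂ (transverseDilation U V p (1 / 4)) :=
    (U.differentiable.add_const p).add ((V.differentiable.sub_const p).fun_const_smul _)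
  obtain ⟨hm, hle⟩ := hmain f
    (fun z => transverseRemainder h hp m f (transverseDilation U V p (1 / 4) z)) (2 * 2⁻¹ ^ m)
    ((transverseRemainder h hp m f).differentiable.comp hd) (by positivity) fun z => by
      rw [transverseRemainder_apply]
      simp_rw [h.transverseCoeff_transverseDilation hp f.differentiable]
      exact norm_sub_sum_taylorCoeff_le (r := 1 / 2)
        (differentiable_comp_transverseDilation (U := U) (V := V) (p := p) f.differentiable z)
        (by norm_num) (by norm_num) m
  exact ⟨_, hle.trans_eq (by ring), fun z => rfl⟩

theorem boundedComposition_of_contraction (h : ContractionSplitting A U V) (hp : V p = p) (k : ℕ)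
    (c : ℂ) (hc : ∀ x, ‖c • (A ^ k) (V x)‖ ≤ 1 / 4 * ‖V x‖) :
    BoundedComposition fun z => (A ^ k) (U z) + p + c • (A ^ k) (V z - p) := by
  obtain ⟨K, hK, hmain⟩ := h.exists_norm_le_of_circle_average hp k c hc
  have hd : Differentiable ℂ fun z => (A ^ k) (U z) + p + c • (A ^ k) (V z - p) :=
    (((A ^ k).differentiable.comp U.differentiable).add_const p).add
      (((A ^ k).differentiable.comp (V.differentiable.sub_const p)).fun_const_smul c)
  have h1 : ∀ f : Fock n, ∃ hm : (fun z => f ((A ^ k) (U z) + p + c • (A ^ k) (V z - p))) ∈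
      fockSubmodule n, ‖Fock.mk _ hm‖ ≤ 1 * K * ‖f‖ := fun f =>
    hmain f _ 1 (f.differentiable.comp hd) zero_le_one fun z => by
      have := norm_taylorCoeff_mul_pow_le (r := 1 / 2) (differentiable_comp_line f.differentiable
        ((A ^ k) (U z) + p + c • (A ^ k) (V z - p)) (V z - p)) (by norm_num) 0
      simpa [taylorCoeff] using this
  exact ⟨fun f => (h1 f).choose, _, fun f => (h1 f).choose_spec⟩

theorem exists_norm_pow_mul_transverseRemainder_lt (h : ContractionSplitting A U V)
    (hA : ∀ x, ‖A x‖ ≤ ‖x‖) (hp : V p = p) {T : Fock n →L[ℂ] Fock n}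
    (hT : ∀ f z, T f z = f (A (U z) + p + A (V z - p))) :
    ∃ k : ℕ, ∀ ε : ℝ, 0 < ε → ∃ m, ‖T ^ k * transverseRemainder h hp m‖ < ε := by
  -- `T ^ k` is split as the dilation by `1 / 4`, which makes the remainder small, and composition
  -- with `4 • A ^ k` on the `V`-part; this needs `4 / 16 = 1 / 4` to be bounded. Neither `k` nor
  -- the second operator depends on `m`.
  obtain ⟨k, -, hk⟩ := h.exists_norm_pow_V_le hA (ε := 1 / 16) (by norm_num)
  have hc : ∀ x, ‖(4 : ℂ) • (A ^ k) (V x)‖ ≤ 1 / 4 * ‖V x‖ := fun x => by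
    rw [norm_smul, Complex.norm_ofNat]
    linarith [hk x]
  set D := compositionOperator _ (boundedComposition_of_contraction h hp k 4 hc)
  obtain ⟨K, hK, hrem⟩ := exists_transverseRemainder_bound h hp
  have hTk : ∀ (k : ℕ) (f : Fock n) (z : CSpace n),
      (T ^ k) f z = f ((A ^ k) (U z) + p + (A ^ k) (V z - p)) := by
    intro k
    induction k with
    | zero =>
      intro f z
      change f z = f (U z + p + (V z - p))
      congr 1
      conv_lhs => rw [← h.add_apply z]
      abel
    | succ k ih =>
      intro f z
      rw [pow_succ]
      change (T ^ k) (T f) z = _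
      rw [ih, hT]
      congr 1
      have hVp : V z - p = V (z - p) := by rw [map_sub, hp]
      have hUw : U ((A ^ k) (U z) + p + (A ^ k) (V z - p)) = (A ^ k) (U z) := by
        rw [map_add, map_add, h.U_pow, h.comp_self, h.U_fixed hp, hVp, h.U_pow, h.U_V]
        simp
      have hVw : V ((A ^ k) (U z) + p + (A ^ k) (V z - p)) - p = (A ^ k) (V z - p) := by
        rw [map_add, map_add, h.V_pow, h.V_U, hp, hVp, h.V_pow, h.V_V]
        simp
      rw [hUw, hVw, pow_succ']
      rfl
  refine ⟨k, fun ε hε => ?_⟩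
  have hlim : Filter.Tendsto (fun m : ℕ => ‖D‖ * K * (2⁻¹ : ℝ) ^ m) Filter.atTop (nhds 0) := by
    simpa using (tendsto_pow_atTop_nhds_zero_of_lt_one (r := (2⁻¹ : ℝ)) (by norm_num)
      (by norm_num)).const_mul (‖D‖ * K)
  obtain ⟨m, hm⟩ := (hlim.eventually_lt_const hε).exists
  refine ⟨m, lt_of_le_of_lt (ContinuousLinearMap.opNorm_le_bound _ (by positivity) fun f => ?_) hm⟩
  obtain ⟨g, hg, hgz⟩ := hrem m f
  have h1 : (T ^ k * transverseRemainder h hp m) f = D g := by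
    refine DFunLike.ext _ _ fun z => ?_
    change (T ^ k) (transverseRemainder h hp m f) z =
      g ((A ^ k) (U z) + p + (4 : ℂ) • (A ^ k) (V z - p))
    rw [hTk, hgz]
    congr 1
    have hVp : V z - p = V (z - p) := by rw [map_sub, hp]
    rw [transverseDilation, hVp]
    simp only [map_add, map_smul, h.U_pow, h.V_pow, h.comp_self, h.V_U, h.U_V, h.V_V, hp,
      h.U_fixed hp, map_zero, smul_zero, add_zero, zero_add, add_sub_cancel_left, smul_smul]
    norm_num
  rw [h1]
  calc ‖D g‖ ≤ ‖D‖ * ‖g‖ := D.le_opNorm g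
    _ ≤ ‖D‖ * (2⁻¹ ^ m * K * ‖f‖) := by gcongr
    _ = _ := by ring

end TransverseExpansion

/-! ### Invertibility of `R * S - μ` -/

section Invertibility

variable {n : ℕ} {A U V : CSpace n →L[ℂ] CSpace n} {p : CSpace n}

/-- The eigenvalues of a linear map. -/
def eigenvalueSet {E : Type*} [AddCommGroup E] [Module ℂ E] (N : E →ₗ[ℂ] E) : Set ℂ :=
  {a | ∃ x, x ≠ 0 ∧ N x = a • x}

/-- With the `U`-part frozen, a homogeneous function of degree `j` is the diagonal of a `j`-linear
form, on which `S` acts by composition with `A * V` in every variable. -/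
theorem exists_aeval_mul_transverseProjection_eq_zero (h : ContractionSplitting A U V)
    (hp : V p = p) {S : Fock n →L[ℂ] Fock n} (hS : ∀ f z, S f z = f (U z + p + A (V z - p)))
    (j : ℕ) : ∃ m : Multiset ℂ,
      (∀ a ∈ m, a ∈ eigenvalueSet ((A * V : CSpace n →L[ℂ] CSpace n) : CSpace n →ₗ[ℂ] CSpace n) ^ j)
      ∧ aeval S (m.map fun a => X - C a).prod * transverseProjection h hp j = 0 := by
  set N : CSpace n →ₗ[ℂ] CSpace n := ((A * V : CSpace n →L[ℂ] CSpace n) : CSpace n →ₗ[ℂ] CSpace n)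
  have hNx : ∀ x, N x = A (V x) := fun _ => rfl
  have hN : AlgebraicWithRoots N (eigenvalueSet N) := exists_multiset_eigenvalues_aeval_eq_zero N
  obtain ⟨m, hm, hm0⟩ := algebraicWithRoots_initialSlotMap hN (le_refl j)
  refine ⟨m, hm, ContinuousLinearMap.ext fun f => DFunLike.ext _ _ fun z => ?_⟩
  set q := (m.map fun a => X - C a).prod
  set Φ : Fock n →ₗ[ℂ] (CSpace n → ℂ) :=
    { toFun := fun G y => G (U z + p + V y)
      map_add' := fun _ _ => rfl
      map_smul' := fun _ _ => rfl }
  set b : Module.End ℂ (CSpace n → ℂ) := LinearMap.funLeft ℂ ℂ N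
  set Ψ : MultilinearMap ℂ (fun _ : Fin j => CSpace n) ℂ →ₗ[ℂ] (CSpace n → ℂ) :=
    { toFun := fun M y => M fun _ => y
      map_add' := fun _ _ => rfl
      map_smul' := fun _ _ => rfl }
  set M : MultilinearMap ℂ (fun _ : Fin j => CSpace n) ℂ := (j.factorial : ℂ)⁻¹ •
    (iteratedFDeriv ℂ j f (U z + p)).toMultilinearMap.compLinearMap
      fun _ => (V : CSpace n →ₗ[ℂ] CSpace n)
  have hUy : ∀ y, U (U z + p + V y) = U z := fun y => by
    rw [map_add, map_add, h.comp_self, h.U_fixed hp, h.U_V, add_zero, add_zero]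
  have hVy : ∀ y, V (U z + p + V y) - p = V y := fun y => by
    rw [map_add, map_add, h.V_U, hp, h.V_V, zero_add, add_sub_cancel_left]
  have h1 : Φ (aeval (S : Module.End ℂ (Fock n)) q (transverseProjection h hp j f)) =
      aeval b q (Φ (transverseProjection h hp j f)) := by
    refine map_aeval_of_intertwines Φ (fun G => funext fun y => ?_) q _
    change S G (U z + p + V y) = G (U z + p + V (N y))
    rw [hS, hUy, hVy, hNx, h.V_A, h.V_V]
  have h2 : Φ (transverseProjection h hp j f) = Ψ M := by
    funext y
    change transverseProjection h hp j f (U z + p + V y) = _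
    rw [transverseProjection_apply, transverseCoeff_eq f.differentiable, hUy, hVy]
    rfl
  have h3 : Ψ (aeval (initialSlotMap N j) q M) = aeval b q (Ψ M) := by
    refine map_aeval_of_intertwines Ψ (fun M' => funext fun y => ?_) q _
    change initialSlotMap N j M' (fun _ => y) = M' fun _ => N y
    rw [initialSlotMap_apply]
    simp
  rw [h2, ← h3, hm0, LinearMap.zero_apply, map_zero] at h1
  -- The choice `y = z - p` brings the slice `U z + p + V y` back to `z`.
  have h4 : (aeval (S : Module.End ℂ (Fock n)) q (transverseProjection h hp j f))
      (U z + p + V (z - p)) = 0 := congrFun h1 (z - p)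
  have h5 : U z + p + V (z - p) = z := by
    rw [map_sub, hp]
    conv_rhs => rw [← h.add_apply z]
    abel
  rw [h5] at h4
  let ι : (Fock n →L[ℂ] Fock n) →ₐ[ℂ] Module.End ℂ (Fock n) :=
    { toFun := fun L => L.toLinearMap
      map_one' := rfl
      map_mul' := fun _ _ => rfl
      map_zero' := rfl
      map_add' := fun _ _ => rfl
      commutes' := fun _ => rfl }
  have h6 : (aeval S q : Fock n →L[ℂ] Fock n).toLinearMap =
      aeval (S : Module.End ℂ (Fock n)) q :=
    (aeval_algHom_apply ι S q).symm
  change (aeval S q : Fock n →L[ℂ] Fock n).toLinearMap (transverseProjection h hp j f) z = 0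
  rw [h6, h4]

theorem isUnit_mul_sub_algebraMap (h : ContractionSplitting A U V) (hA : ∀ x, ‖A x‖ ≤ ‖x‖)
    (hp : V p = p) {R S : Fock n →L[ℂ] Fock n} (hR : ∀ f z, R f z = f (A (U z) + V z))
    (hS : ∀ f z, S f z = f (U z + p + A (V z - p))) {μ : ℂ} (hμ : μ ≠ 0)
    (hunit : ∀ j : ℕ, ∀ a ∈ eigenvalueSet ((A * V : CSpace n →L[ℂ] CSpace n) :
      CSpace n →ₗ[ℂ] CSpace n) ^ j, IsUnit (algebraMap ℂ _ a * R - algebraMap ℂ _ μ)) :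
    IsUnit (R * S - algebraMap ℂ _ μ) := by
  have hUp := h.U_fixed hp
  have hUVp : ∀ z, U (V z - p) = 0 := fun z => by rw [map_sub, h.U_V, hUp, sub_zero]
  have hVVp : ∀ z, V (V z - p) = V z - p := fun z => by rw [map_sub, h.V_V, hp]
  have hPR : ∀ j, Commute (transverseProjection h hp j) R := fun j =>
    commute_transverseProjection h hp j hR fun t z => by
      simp only [transverseDilation, map_add, map_smul, h.comp_self, h.U_V, h.V_U, h.V_V, h.V_A,
        hp, hUp, hUVp, hVVp, map_zero, smul_zero, add_zero, zero_add, ← h.comm]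
      abel
  have hPS : ∀ j, Commute (transverseProjection h hp j) S := fun j =>
    commute_transverseProjection h hp j hS fun t z => by
      simp only [transverseDilation, map_add, map_smul, h.comp_self, h.V_U, h.V_A,
        hp, hUp, hUVp, hVVp, map_zero, smul_zero, add_zero, zero_add, add_sub_cancel_left,
        ← h.comm]
  have hRS : Commute R S := by
    refine ContinuousLinearMap.ext fun f => DFunLike.ext _ _ fun z => ?_
    change R (S f) z = S (R f) z
    rw [hR, hS, hS, hR]
    congr 1
    simp only [map_add, h.comp_self, h.U_V, h.V_U, h.V_V, h.V_A, hp, hUp, hUVp, hVVp, map_zero,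
      add_zero, zero_add, ← h.comm]
    abel
  have hT : ∀ f z, (R * S) f z = f (A (U z) + p + A (V z - p)) := fun f z => by
    change R (S f) z = _
    rw [hR, hS]
    congr 1
    simp only [map_add, h.comp_self, h.U_V, h.V_U, h.V_V, h.V_A, add_zero, zero_add, map_zero,
      ← h.comm]
  obtain ⟨k, hk⟩ := exists_norm_pow_mul_transverseRemainder_lt h hA hp hT
  obtain ⟨m, hm⟩ := hk (‖μ‖ ^ k / (‖(1 : Fock n →L[ℂ] Fock n)‖ + 1)) (by positivity)
  have hPT : ∀ j, Commute (transverseProjection h hp j) (R * S) := fun j =>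
    (hPR j).mul_right (hPS j)
  have hQT : Commute (transverseRemainder h hp m) (R * S) :=
    (Commute.one_left _).sub_left (Commute.sum_left _ _ _ fun j _ => hPT j)
  obtain ⟨yQ, hyQT, hyQ⟩ := exists_relative_inverse_of_pow (x := R * S) (μ := μ) (k := k) hQT
    (transverseRemainder_mul_self h hp m) (by
      rw [lt_div_iff₀ (by positivity)] at hm
      refine lt_of_le_of_lt ?_ hm
      gcongr
      linarith)
  have hy : ∀ j, ∃ y, Commute y (R * S) ∧
      (R * S - algebraMap ℂ _ μ) * y = transverseProjection h hp j := by
    intro j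
    obtain ⟨l, hl, hl0⟩ := exists_aeval_mul_transverseProjection_eq_zero h hp hS j
    obtain ⟨y, hyR, hyS, hy⟩ := exists_relative_inverse hRS μ l (fun a ha => hunit j a (hl a ha))
      (hPR j) (hPS j) hl0
    exact ⟨y, hyR.mul_right hyS, hy⟩
  choose y hyT hy using hy
  -- The projections of degree less than `m` and the remainder sum to `1`, so the relative inverses
  -- sum to an inverse.
  set Y := yQ + ∑ j ∈ Finset.range m, y j
  have hYT : Commute Y (R * S - algebraMap ℂ _ μ) :=
    (hyQT.add_left (Commute.sum_left _ _ _ fun j _ => hyT j)).sub_right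
      (Algebra.commute_algebraMap_right μ Y)
  have hY : (R * S - algebraMap ℂ _ μ) * Y = 1 := by
    rw [mul_add, hyQ, Finset.mul_sum, Finset.sum_congr rfl fun j _ => hy j, transverseRemainder,
      sub_add_cancel]
  exact ⟨⟨_, Y, hY, hYT.eq.trans hY⟩, rfl⟩

end Invertibility

/-! ### Subgroups of the circle -/

section CircleSubgroups

theorem dense_or_finite_subgroup_circle (G : Subgroup Circle) :
    Dense (G : Set Circle) ∨ Finite G := by
  have hfact : Fact (0 < (1 : ℝ)) := ⟨one_pos⟩
  set s : AddSubgroup (AddCircle (1 : ℝ)) :=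
    { carrier := {x | AddCircle.toCircle x ∈ G}
      add_mem' := fun {x y} hx hy => by
        rw [Set.mem_ofPred_eq, AddCircle.toCircle_add]
        exact G.mul_mem hx hy
      zero_mem' := by
        rw [Set.mem_ofPred_eq, AddCircle.toCircle_zero]
        exact G.one_mem
      neg_mem' := fun {x} hx => by
        rw [Set.mem_ofPred_eq, AddCircle.toCircle_neg]
        exact G.inv_mem hx }
  have hsurj : Function.Surjective (AddCircle.toCircle : AddCircle (1 : ℝ) → Circle) := fun x => by
    obtain ⟨y, hy⟩ := (AddCircle.homeomorphCircle (one_ne_zero (α := ℝ))).surjective x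
    exact ⟨y, by rw [← hy, AddCircle.homeomorphCircle_apply]⟩
  have himage : AddCircle.toCircle '' (s : Set (AddCircle (1 : ℝ))) = G :=
    Set.image_preimage_eq (G : Set Circle) hsurj
  by_cases hs : Dense (s : Set (AddCircle (1 : ℝ)))
  · left
    rw [← himage]
    exact hsurj.denseRange.dense_image AddCircle.continuous_toCircle hs
  · right
    rw [AddCircle.dense_addSubgroup_iff_ne_zmultiples] at hs
    push Not at hs
    obtain ⟨a, ha, hsa⟩ := hs
    have hfin : (s : Set (AddCircle (1 : ℝ))).Finite := by
      rw [hsa]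
      exact (finite_zmultiples (a := a)).2 (addOrderOf_ne_zero_iff.1 ha)
    have := hfin.image AddCircle.toCircle
    rw [himage] at this
    exact this

/-- The elements of `G` are `Nat.card G` distinct roots of unity of that order, hence all of them.
-/
theorem mem_of_pow_card_eq_one (G : Subgroup Circle) [Finite G] {x : Circle}
    (hx : x ^ Nat.card G = 1) : x ∈ G := by
  classical
  have hpos : 0 < Nat.card G := Nat.card_pos
  have := Fintype.ofFinite G
  have hinj : Function.Injective fun g : G => ((g : Circle) : ℂ) :=
    Circle.coe_injective.comp Subtype.val_injective
  set s : Finset ℂ := Finset.univ.image fun g : G => ((g : Circle) : ℂ)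
  have hcard : s.card = Nat.card G := by
    rw [Finset.card_image_of_injective _ hinj, Finset.card_univ, Nat.card_eq_fintype_card]
  have hsub : s ⊆ nthRootsFinset (Nat.card G) (1 : ℂ) := by
    intro y hy
    obtain ⟨g, -, rfl⟩ := Finset.mem_image.1 hy
    rw [mem_nthRootsFinset hpos, ← Circle.coe_pow, ← Subgroup.coe_pow, pow_card_eq_one']
    simp
  have heq : s = nthRootsFinset (Nat.card G) (1 : ℂ) := by
    refine Finset.eq_of_subset_of_card_le hsub ?_
    rw [hcard, nthRootsFinset_def]
    exact (Multiset.toFinset_card_le _).trans (card_nthRoots _ _)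
  have hmem : (x : ℂ) ∈ s := by
    rw [heq, mem_nthRootsFinset hpos, ← Circle.coe_pow, hx, Circle.coe_one]
  obtain ⟨g, -, hg⟩ := Finset.mem_image.1 hmem
  rw [← Circle.coe_injective hg]
  exact g.2

/-- If every torsion relation satisfied by the unimodular elements of `s` is satisfied by the
unimodular number `x`, then `x` is a limit of products of elements of `s`. -/
theorem mem_closure_submonoidClosure_of_torsion {s : Set ℂ} {x : ℂ} (hx : ‖x‖ = 1)
    (h : ∀ N : ℕ, (∀ l ∈ s, ‖l‖ = 1 → l ^ N = 1) → x ^ N = 1) :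
    x ∈ closure (Submonoid.closure s : Set ℂ) := by
  set c : Set Circle := {l | (l : ℂ) ∈ s}
  obtain ⟨y, rfl⟩ : ∃ y : Circle, (y : ℂ) = x := ⟨⟨x, mem_sphere_zero_iff_norm.2 hx⟩, rfl⟩
  have hy : y ∈ closure (Submonoid.closure c : Set Circle) := by
    -- In a compact group inverses are limits of positive powers, so a submonoid and the subgroup it
    -- generates have the same closure.
    rw [closure_submonoidClosure_eq_closure_subgroupClosure]
    rcases dense_or_finite_subgroup_circle (Subgroup.closure c) with hd | hf
    · exact hd y
    · refine subset_closure (mem_of_pow_card_eq_one _ ?_)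
      refine Circle.coe_injective ?_
      rw [Circle.coe_pow, Circle.coe_one]
      refine h _ fun l hl hl1 => ?_
      set l' : Circle := ⟨l, mem_sphere_zero_iff_norm.2 hl1⟩
      have hl' : l' ∈ Subgroup.closure c := Subgroup.subset_closure hl
      have h1 : (⟨l', hl'⟩ : Subgroup.closure c) ^ Nat.card (Subgroup.closure c) = 1 :=
        pow_card_eq_one'
      exact congrArg (fun g : Subgroup.closure c => ((g : Circle) : ℂ)) h1
  have hle : Submonoid.closure c ≤ (Submonoid.closure s).comap Circle.coeHom :=
    Submonoid.closure_le.2 fun l hl => Submonoid.subset_closure hl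
  exact map_mem_closure continuous_subtype_val hy fun l hl => hle hl

end CircleSubgroups

/-! ### Eigenfunctions of the composition operator -/

section Eigenfunctions

variable {E : Type*} [NormedAddCommGroup E] [NormedSpace ℂ E] [FiniteDimensional ℂ E]

/-- A nonzero functional vanishing on the proper subspace `range (A - a)`. -/
theorem exists_eigenfunctional {A : E →L[ℂ] E} {a : ℂ}
    (ha : a ∈ eigenvalueSet (A : E →ₗ[ℂ] E)) : ∃ l : E →L[ℂ] ℂ, l ≠ 0 ∧ ∀ x, l (A x) = a * l x := by
  obtain ⟨x, hx, hxa⟩ := ha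
  set N : E →ₗ[ℂ] E := (A : E →ₗ[ℂ] E) - a • LinearMap.id
  have hlt : LinearMap.range N < ⊤ := by
    refine lt_top_iff_ne_top.2 fun htop => hx ?_
    have hinj := LinearMap.injective_iff_surjective.2 (LinearMap.range_eq_top.1 htop)
    refine hinj ?_
    have hxa' : A x = a • x := hxa
    simp [N, hxa']
  obtain ⟨l, hl, hle⟩ := Submodule.exists_le_ker_of_lt_top _ hlt
  refine ⟨LinearMap.toContinuousLinearMap l, fun h0 => hl ?_, fun y => ?_⟩
  · ext y
    exact congrArg (fun L : E →L[ℂ] ℂ => L y) h0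
  · have h1 : l (N y) = 0 := hle ⟨y, rfl⟩
    simpa [N, sub_eq_zero] using h1

/-- Products of eigenvalues have eigenfunctions of polynomial growth. -/
theorem exists_eigenfunction {A : E →L[ℂ] E} {a : ℂ}
    (ha : a ∈ Submonoid.closure (eigenvalueSet (A : E →ₗ[ℂ] E))) :
    ∃ (g : E → ℂ) (c : ℝ) (m : ℕ), Differentiable ℂ g ∧ Dense {y | g y ≠ 0} ∧
      (∀ y, ‖g y‖ ≤ c * (1 + ‖y‖) ^ m) ∧ ∀ y, g (A y) = a * g y := by
  induction ha using Submonoid.closure_induction with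
  | mem a ha =>
    obtain ⟨l, hl, hla⟩ := exists_eigenfunctional ha
    refine ⟨l, ‖l‖, 1, l.differentiable, ?_, fun y => ?_, hla⟩
    · have h1 : {y | l y ≠ 0} = ((LinearMap.ker (l : E →ₗ[ℂ] ℂ) : Submodule ℂ E) : Set E)ᶜ := by
        ext y
        simp
      rw [h1, ← interior_eq_empty_iff_dense_compl, ← Set.not_nonempty_iff_eq_empty]
      intro h2
      have h3 := Submodule.eq_top_of_nonempty_interior' _ h2
      refine hl (ContinuousLinearMap.ext fun y => ?_)
      have : y ∈ LinearMap.ker (l : E →ₗ[ℂ] ℂ) := h3 ▸ Submodule.mem_top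
      exact this
    · rw [pow_one]
      refine (l.le_opNorm y).trans ?_
      gcongr
      linarith
  | one =>
    exact ⟨fun _ => 1, 1, 0, differentiable_const _, by simp, by simp, by simp⟩
  | mul a b _ _ iha ihb =>
    obtain ⟨g, c, m, hg, hgd, hgb, hga⟩ := iha
    obtain ⟨g', c', m', hg', hgd', hgb', hga'⟩ := ihb
    refine ⟨fun y => g y * g' y, c * c', m + m', hg.mul hg', ?_, fun y => ?_, fun y => ?_⟩
    · have h1 : {y | g y * g' y ≠ 0} = {y | g y ≠ 0} ∩ {y | g' y ≠ 0} := by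
        ext y
        simp
      rw [h1]
      -- Carrying density of the nonvanishing set, rather than mere nonvanishing, keeps products
      -- nonzero.
      exact hgd.inter_of_isOpen_left hgd' (isOpen_ne_fun hg.continuous continuous_const)
    · rw [norm_mul, pow_add, mul_mul_mul_comm]
      exact mul_le_mul (hgb y) (hgb' y) (norm_nonneg _) ((norm_nonneg _).trans (hgb y))
    · simp only [hga, hga']
      ring

theorem mem_spectrum_compositionOperator {n : ℕ} {φ : CSpace n → CSpace n}
    (hb : BoundedComposition φ) {A : CSpace n →L[ℂ] CSpace n} {p : CSpace n}
    (hφ : ∀ z, φ z - p = A (z - p)) {a : ℂ}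
    (ha : a ∈ Submonoid.closure (eigenvalueSet (A : CSpace n →ₗ[ℂ] CSpace n))) :
    a ∈ spectrum ℂ (compositionOperator φ hb) := by
  obtain ⟨g, c, m, hg, hgd, hgb, hga⟩ := exists_eigenfunction ha
  have hc : 0 ≤ c := by simpa using (norm_nonneg _).trans (hgb 0)
  have hgp : Differentiable ℂ fun z => g (z - p) := hg.comp (differentiable_id.sub_const p)
  have hmem : (fun z => g (z - p)) ∈ fockSubmodule n := by
    refine mem_fockSubmodule_of_norm_le_exp hgp
      (c := c * (m.factorial * Real.exp (‖p‖ + 3))) fun z => (hgb (z - p)).trans ?_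
    rw [mul_assoc, mul_assoc, ← Real.exp_add]
    have h1 : (1 + ‖z - p‖) ^ m ≤ m.factorial * Real.exp (1 + ‖z - p‖) := by
      have := Real.pow_div_factorial_le_exp (1 + ‖z - p‖) (by positivity) m
      rwa [div_le_iff₀ (by positivity), mul_comm] at this
    refine mul_le_mul_of_nonneg_left (h1.trans ?_) hc
    refine mul_le_mul_of_nonneg_left (Real.exp_le_exp.2 ?_) (by positivity)
    -- `‖z‖ ≤ ‖z‖² / 8 + 2` is the square of `‖z‖ - 4`; this explains `3 = 1 + 2` in the constant.
    nlinarith [norm_sub_le z p, sq_nonneg (‖z‖ - 4)]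
  obtain ⟨y, hy⟩ := hgd.nonempty
  set f : Fock n := Fock.mk _ hmem
  have hf0 : f ≠ 0 := by
    intro h0
    have h1 : f (y + p) = (0 : Fock n) (y + p) := by rw [h0]
    refine hy ?_
    change g (y + p - p) = 0 at h1
    rwa [add_sub_cancel_right] at h1
  have hTf : compositionOperator φ hb f = a • f := by
    refine DFunLike.ext _ _ fun z => ?_
    change g (φ z - p) = a * g (z - p)
    rw [hφ, hga]
  intro hunit
  have hu : IsUnit (algebraMap ℂ (Fock n →L[ℂ] Fock n) a - compositionOperator φ hb) := hunit
  refine hf0 ((ContinuousLinearMap.isUnit_iff_bijective.1 hu).1 ?_)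
  rw [map_zero, _root_.sub_apply, hTf]
  exact sub_self _

end Eigenfunctions

/-! ### The spectrum for an affine symbol -/

section Spectrum

variable {n : ℕ}

theorem mem_pow_eigenvalueSet_mul {A U V : CSpace n →L[ℂ] CSpace n}
    (h : ContractionSplitting A U V) (hA : ∀ x, ‖A x‖ ≤ ‖x‖) (j : ℕ) {a : ℂ}
    (ha : a ∈ eigenvalueSet ((A * V : CSpace n →L[ℂ] CSpace n) : CSpace n →ₗ[ℂ] CSpace n) ^ j) :
    a = 0 ∨ a ∈ Submonoid.closure (eigenvalueSet (A : CSpace n →ₗ[ℂ] CSpace n)) := by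
  induction j generalizing a with
  | zero =>
    rw [pow_zero, Set.mem_one] at ha
    exact Or.inr (ha ▸ Submonoid.one_mem _)
  | succ j ih =>
    rw [pow_succ] at ha
    obtain ⟨b, hb, c, ⟨x, hx, hxc⟩, rfl⟩ := Set.mem_mul.1 ha
    rcases ih hb with rfl | hb
    · exact Or.inl (zero_mul c)
    rcases eq_or_ne c 0 with rfl | hc
    · exact Or.inl (mul_zero b)
    · exact Or.inr (Submonoid.mul_mem _ hb
        (Submonoid.subset_closure ⟨x, hx, (h.eigenvector_of_ne_zero hA hx hc hxc).1⟩))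

theorem spectrum_compositionOperator_eq {φ : CSpace n → CSpace n} (hb : BoundedComposition φ)
    {A : CSpace n →L[ℂ] CSpace n} {B : CSpace n} (hφ : ∀ z, φ z = A z + B) :
    spectrum ℂ (compositionOperator φ hb) =
      closure (Submonoid.closure (eigenvalueSet (A : CSpace n →ₗ[ℂ] CSpace n)) : Set ℂ) := by
  obtain ⟨c, hc, hle⟩ := exists_norm_sq_le_of_boundedComposition hb
  have hA : ∀ x, ‖A x‖ ≤ ‖x‖ := by
    intro x
    by_contra! hx
    set d := Real.sqrt c + ‖B‖
    have h1 : ∀ t : ℝ, 0 ≤ t → t * ‖A x‖ ≤ t * ‖x‖ + d := by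
      intro t ht
      have h2 := norm_le_add_sqrt (norm_nonneg _) hc (hle ((t : ℂ) • x))
      have h3 : ‖(t : ℂ) • A x‖ ≤ ‖(t : ℂ) • A x + B‖ + ‖B‖ := by
        have := norm_sub_le ((t : ℂ) • A x + B) B
        rwa [add_sub_cancel_right] at this
      rw [hφ, map_smul, norm_smul (t : ℂ) x] at h2
      rw [norm_smul] at h3
      rw [Complex.norm_of_nonneg ht] at h2 h3
      linarith
    have hpos : 0 < ‖A x‖ - ‖x‖ := sub_pos.2 hx
    have hd : 0 ≤ d := by positivity
    have h4 := h1 ((d + 1) / (‖A x‖ - ‖x‖)) (by positivity)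
    have h5 : (d + 1) / (‖A x‖ - ‖x‖) * (‖A x‖ - ‖x‖) = d + 1 := div_mul_cancel₀ _ hpos.ne'
    linarith
  obtain ⟨U, V, h⟩ := exists_contractionSplitting hA
  -- For a unimodular eigenvector `y`, the growth estimate at `(t * l⁻¹) • y` reads `‖t • y + B‖² ≤
  -- ‖t • y‖² + c`, which forces `B ⟂ y`.
  have hUB : U B = 0 := by
    have h1 : ∀ y ∈ Submodule.span ℂ (unimodularEigenvectors A), inner ℂ y B = 0 := by
      intro y hy
      induction hy using Submodule.span_induction with
      | mem y hy =>
        obtain ⟨l, hl, hyl⟩ := hy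
        have hl0 : l ≠ 0 := by
          rintro rfl
          simp at hl
        refine inner_eq_zero_of_norm_sq_le (c := c) fun t => ?_
        have h2 := hle ((t * l⁻¹) • y)
        rw [hφ, map_smul, hyl, smul_smul, mul_assoc, inv_mul_cancel₀ hl0, mul_one] at h2
        refine h2.trans_eq ?_
        rw [norm_smul, norm_smul, norm_mul, norm_inv, hl, inv_one, mul_one]
      | zero => simp
      | add y z _ _ h1 h2 => rw [inner_add_left, h1, h2, add_zero]
      | smul c y _ h1 => rw [inner_smul_left, h1, mul_zero]
    have h2 := h1 (U B) (h.mem_span B)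
    conv at h2 => enter [1, 3]; rw [← h.add_apply B]
    rw [inner_add_right, h.inner_eq_zero, add_zero] at h2
    exact inner_self_eq_zero.1 h2
  have hVB : V B = B := by rw [h.V_eq, hUB, sub_zero]
  obtain ⟨p, hp, hpB⟩ := h.exists_fixed hA hVB
  have hφp : ∀ z, φ z - p = A (z - p) := fun z => by
    rw [hφ, map_sub]
    nth_rewrite 1 [← hpB]
    abel
  set D := Submonoid.closure (eigenvalueSet (A : CSpace n →ₗ[ℂ] CSpace n))
  refine Set.Subset.antisymm (fun μ hμ => ?_)
    (closure_minimal (fun a ha => mem_spectrum_compositionOperator hb hφp ha)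
      (spectrum.isClosed _))
  obtain ⟨W, hW⟩ := h.exists_linearIsometryEquiv
  set R := isometryOperator W
  set T := compositionOperator φ hb
  set S := isometryOperator W.symm * T
  have hTRS : R * S = T := by
    rw [← mul_assoc, isometryOperator_mul_symm, one_mul]
  have hR : ∀ f z, R f z = f (A (U z) + V z) := fun f z => by
    rw [← hW]
    rfl
  have hS : ∀ f z, S f z = f (U z + p + A (V z - p)) := by
    intro f z
    obtain ⟨y, rfl⟩ := W.surjective z
    change f (φ (W.symm (W y))) = _
    rw [W.symm_apply_apply]
    congr 1
    have h1 : U (W y) = A (U y) := by rw [hW, map_add, h.U_V, add_zero, ← h.comm, h.comp_self]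
    have h2 : V (W y) = V y := by rw [hW, map_add, h.V_A, h.V_U, h.V_V, map_zero, zero_add]
    rw [h1, h2, ← sub_add_cancel (φ y) p, hφp, map_sub, map_sub]
    conv_lhs => rw [← h.add_apply y, map_add]
    abel
  have hspecR : spectrum ℂ R ⊆ closure (D : Set ℂ) := by
    intro ν hν
    refine mem_closure_submonoidClosure_of_torsion
      (norm_eq_one_of_mem_spectrum_isometryOperator hν) fun N hN => ?_
    refine pow_eq_one_of_mem_spectrum_isometryOperator (fun z => ?_) hν
    have hN' : ∀ (x : CSpace n) (l : ℂ), x ≠ 0 → ‖l‖ = 1 → A x = l • x → l ^ N = 1 :=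
      fun x l hx hl hxl => hN l (show ∃ x, x ≠ 0 ∧ A x = l • x from ⟨x, hx, hxl⟩) hl
    have h1 := h.pow_eq_self (W := (W.toContinuousLinearEquiv : CSpace n →L[ℂ] CSpace n)) hW hN' z
    rwa [FunLike.coe_pow_eq_iterate] at h1
  by_contra hμD
  refine hμ ?_
  change IsUnit (algebraMap ℂ (Fock n →L[ℂ] Fock n) μ - T)
  rw [← IsUnit.neg_iff, neg_sub]
  rcases eq_or_ne μ 0 with rfl | hμ0
  · have hV0 : ∀ x, V x = 0 := h.V_eq_zero fun x ν hx hxν => by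
      by_contra hν1
      have hνA : ν ∈ eigenvalueSet (A : CSpace n →ₗ[ℂ] CSpace n) := ⟨x, hx, hxν⟩
      have hν : ‖ν‖ < 1 := by
        refine lt_of_le_of_ne ?_ hν1
        have h1 := hA x
        rw [hxν, norm_smul] at h1
        exact le_of_mul_le_mul_right (by rwa [one_mul]) (norm_pos_iff.2 hx)
      -- An eigenvalue of modulus less than `1` would put `0`, the limit of its powers, in the
      -- closure.
      refine hμD (mem_closure_of_tendsto (tendsto_pow_atTop_nhds_zero_of_norm_lt_one hν)
        (Filter.Eventually.of_forall fun k => ?_))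
      exact Submonoid.pow_mem _ (Submonoid.subset_closure hνA) k
    have hS1 : S = 1 := by
      refine ContinuousLinearMap.ext fun f => DFunLike.ext _ _ fun z => ?_
      have hp0 : p = 0 := by rw [← hp, hV0]
      have hUz : U z = z := by
        have := h.add_apply z
        rwa [hV0, add_zero] at this
      rw [hS, hV0, hp0, hUz, sub_zero, map_zero, add_zero, add_zero]
      rfl
    rw [map_zero, sub_zero, ← hTRS, hS1, mul_one]
    exact (isometryUnit W).isUnit
  · rw [← hTRS]
    refine isUnit_mul_sub_algebraMap h hA hp hR hS hμ0 fun j a ha => ?_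
    rcases mem_pow_eigenvalueSet_mul h hA j ha with rfl | haD
    · rw [map_zero, zero_mul, zero_sub, IsUnit.neg_iff]
      exact (isUnit_iff_ne_zero.2 hμ0).map (algebraMap ℂ (Fock n →L[ℂ] Fock n))
    rcases eq_or_ne a 0 with rfl | ha0
    · rw [map_zero, zero_mul, zero_sub, IsUnit.neg_iff]
      exact (isUnit_iff_ne_zero.2 hμ0).map (algebraMap ℂ (Fock n →L[ℂ] Fock n))
    have hnot : a⁻¹ * μ ∉ spectrum ℂ R := fun hmem => by
      refine hμD ?_
      -- The closure of `D` is again a monoid, so `a⁻¹ * μ` in it would put `μ = a * (a⁻¹ * μ)` in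
      -- it.
      have h1 := D.topologicalClosure.mul_mem (subset_closure haD) (hspecR hmem)
      rwa [mul_inv_cancel_left₀ ha0] at h1
    rw [spectrum.notMem_iff] at hnot
    have h1 : algebraMap ℂ (Fock n →L[ℂ] Fock n) a * R - algebraMap ℂ (Fock n →L[ℂ] Fock n) μ =
        algebraMap ℂ (Fock n →L[ℂ] Fock n) (-a) *
          (algebraMap ℂ (Fock n →L[ℂ] Fock n) (a⁻¹ * μ) - R) := by
      rw [mul_sub, ← map_mul, neg_mul, mul_inv_cancel_left₀ ha0, map_neg, map_neg]
      noncomm_ring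
    rw [h1]
    exact ((isUnit_iff_ne_zero.2 (neg_ne_zero.2 ha0)).map _).mul hnot

end Spectrum

/-! ### The theorem, in terms of matrices and eigenvalues with multiplicity -/

theorem theorem4p2 (n : ℕ) (φ : CSpace n → CSpace n) (hφ : Differentiable ℂ φ)
    (hb : BoundedComposition φ) :
    ∃ (A : Matrix (Fin n) (Fin n) ℂ) (B : CSpace n) (lam : Fin n → ℂ),
      (∀ z : CSpace n, φ z = Matrix.toEuclideanLin A z + B) ∧
      -- `lam` lists the eigenvalues of `A` with their algebraic multiplicities
      A.charpoly = ∏ i, (X - C (lam i)) ∧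
      spectrum ℂ (compositionOperator φ hb) =
        closure (Set.range fun α : Fin n → ℕ => ∏ i, lam i ^ α i) := by
  obtain ⟨c, hc, hle⟩ := exists_norm_sq_le_of_boundedComposition hb
  set L := fderiv ℂ φ 0
  have haff : ∀ z, φ z = L z + φ 0 := eq_add_fderiv_of_norm_le_add hφ (Real.sqrt_nonneg c)
    fun w => norm_le_add_sqrt (norm_nonneg _) hc (hle w)
  set A : Matrix (Fin n) (Fin n) ℂ := Matrix.toEuclideanLin.symm (L : CSpace n →ₗ[ℂ] CSpace n)
  have hAL : Matrix.toEuclideanLin A = (L : CSpace n →ₗ[ℂ] CSpace n) :=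
    LinearEquiv.apply_symm_apply _ _
  have hchar : (L : CSpace n →ₗ[ℂ] CSpace n).charpoly = A.charpoly := by
    rw [← hAL]
    exact Matrix.charpoly_toLin A (PiLp.basisFun 2 ℂ (Fin n))
  have hsplit := IsAlgClosed.splits A.charpoly
  have hcard : A.charpoly.roots.toList.length = n := by
    rw [Multiset.length_toList, ← hsplit.natDegree_eq_card_roots, A.charpoly_natDegree_eq_dim,
      Fintype.card_fin]
  set lam : Fin n → ℂ := fun i => A.charpoly.roots.toList.get (i.cast hcard.symm)
  have hlam : Finset.univ.val.map lam = A.charpoly.roots := by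
    rw [← Multiset.coe_toList A.charpoly.roots, Fin.univ_val_map, Multiset.coe_eq_coe]
    refine List.Perm.of_eq (List.ext_getElem (by simp [hcard]) fun i h1 h2 => ?_)
    simp [lam]
  have hprod : A.charpoly = ∏ i, (X - C (lam i)) := by
    conv_lhs => rw [hsplit.eq_prod_roots_of_monic A.charpoly_monic, ← hlam, Multiset.map_map]
    rfl
  -- Multiplicities do not affect the generated monoid, so the set of eigenvalues suffices for the
  -- spectrum.
  have heig : eigenvalueSet (L : CSpace n →ₗ[ℂ] CSpace n) = Set.range lam := by
    ext a
    have h1 : a ∈ eigenvalueSet (L : CSpace n →ₗ[ℂ] CSpace n) ↔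
        Module.End.HasEigenvalue (L : CSpace n →ₗ[ℂ] CSpace n) a := by
      refine ⟨fun ⟨x, hx, hxa⟩ => ?_, fun ha => ?_⟩
      · exact Module.End.hasEigenvalue_of_hasEigenvector
          (Module.End.hasEigenvector_iff.2 ⟨Module.End.mem_eigenspace_iff.2 hxa, hx⟩)
      · obtain ⟨x, hx⟩ := ha.exists_hasEigenvector
        exact ⟨x, hx.2, hx.apply_eq_smul⟩
    rw [h1, Module.End.hasEigenvalue_iff_isRoot_charpoly, hchar,
      ← mem_roots A.charpoly_monic.ne_zero, ← hlam]
    simp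
  refine ⟨A, φ 0, lam, fun z => ?_, hprod, ?_⟩
  · rw [hAL]
    exact haff z
  · rw [spectrum_compositionOperator_eq hb haff, heig]
    congr 1
    ext x
    rw [SetLike.mem_coe, Submonoid.mem_closure_range_iff_of_fintype, Set.mem_range]
    exact exists_congr fun α => eq_comm
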